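/- A $3s/3t$ sum-network is a finite directed acyclic multigraph $\mathscr N=(V,E)$ with three distinct source nodes and three distinct terminal nodes; source $s_i$ generates a symbol $x_i$ of a field $F$, every edge carries one symbol of $F$, and every terminal wants to recover $x_1+x_2+x_3$. The network is connected if there is a directed path (with at least one edge) from every source to every terminal. It is XOR solvable over $F$ if a scalar linear network code in which every node, terminals included, only adds and subtracts symbols available to it (all local coding coefficients, decoding included, lie in $\{0,1,-1\}\subset F$) lets every terminal recover $x_1+x_2+x_3$. A set of edges disconnects a pair $(u,v)$ of nodes if there is a directed path from $u$ to $v$ in $\mathscr N$ but none after these edges are removed; an edge $e$ disconnects $(u,v)$ if $\{e\}$ does. For edges $e,e'$, write $e\to e'$ if the head of $e$ equals the tail of $e'$ or has a directed path to it, and $e\nrightarrow e'$ otherwise. A labelling names the sources $s_1,s_2,s_3$ and, independently, the terminals $t_1,t_2,t_3$. **Lemma.** Suppose that a connected $3s/3t$ sum-network $\mathscr N$ satisfies the following conditions. (1) There are no edges $e_1,e_2$ and no labelling of the sources and the terminals such that - among the nine source-terminal pairs, $e_1$ disconnects exactly $(s_1,t_3)$ and $(s_3,t_1)$; - among the nine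 source-terminal pairs, $e_2$ disconnects exactly $(s_2,t_3)$ and $(s_3,t_2)$; - the minimum cut between $s_3$ and $t_3$ (the least number of edges whose removal leaves no path from $s_3$ to $t_3$) is $0$ in $\mathscr N-\{e_1,e_2\}$; - $e_1\nrightarrow e_2$ and $e_2\nrightarrow e_1$. (2) For some labelling of the sources and the terminals there are two distinct edges $e_1,e_2$ such that - (a) $e_1$ disconnects $(s_1,t_3)$ and $(s_3,t_1)$ (and possibly further pairs); - (b) $e_2$ disconnects $(s_2,t_3)$ and $(s_3,t_2)$ (and possibly further pairs); - (c) $e_1\nrightarrow e_2$ and $e_2\nrightarrow e_1$; - (d) $\{e_1,e_2\}$ does not disconnect $(s_3,t_3)$. Then $\mathscr N$ is XOR solvable over every field $F$. -/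

import Mathlib

/-- A sum-network with `l` sources and `m` terminals: a directed acyclic multigraph with node type
`V` and edge type `E` (the edge `e` runs from `tail e` to `head e`), together with `l` distinct
source nodes and `m` distinct terminal nodes. -/
structure SumNetwork (V E : Type*) (l m : ℕ) where
  tail : E → V
  head : E → V
  source : Fin l → V
  terminal : Fin m → V
  source_injective : Function.Injective source
  terminal_injective : Function.Injective terminal
  acyclic : ∀ v, ¬ Relation.TransGen (fun u w => ∃ e, tail e = u ∧ head e = w) v v

namespace SumNetwork

variable {V E : Type*} {l m : ℕ}

/-- There is an edge from `u` to `w` in the network from which the edges in `R` are removed. -/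
def Step (N : SumNetwork V E l m) (R : Set E) (u w : V) : Prop :=
  ∃ e, e ∉ R ∧ N.tail e = u ∧ N.head e = w

/-- There is a directed path (with at least one edge, so that no node is its own ancestor) from `u`
to `w` in the network from which the edges in `R` are removed. -/
def Reaches (N : SumNetwork V E l m) (R : Set E) (u w : V) : Prop :=
  Relation.TransGen (N.Step R) u w

/-- `e₁ → e₂`: a directed path runs through `e₁` and, after that, through `e₂`; that is, there is a
possibly empty path from the head of `e₁` to the tail of `e₂`. -/
def EdgeReaches (N : SumNetwork V E l m) (e₁ e₂ : E) : Prop :=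
  N.head e₁ = N.tail e₂ ∨ N.Reaches ∅ (N.head e₁) (N.tail e₂)

/-- Every source has a path to every terminal. -/
def Connected (N : SumNetwork V E l m) : Prop :=
  ∀ i j, N.Reaches ∅ (N.source i) (N.terminal j)

/-- Removing the edges in `R` disconnects the ordered pair of nodes `(u, w)`. -/
def Disconnects (N : SumNetwork V E l m) (R : Set E) (u w : V) : Prop :=
  N.Reaches ∅ u w ∧ ¬ N.Reaches R u w

/-- The minimum cut between `A` and `B` in the network from which the edges in `R` are removed: the
least number of further edges whose removal leaves no path from any node of `A` to any node
of `B`. -/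
noncomputable def minCut (N : SumNetwork V E l m) (R : Set E) (A B : Set V) : ℕ :=
  sInf {n | ∃ D : Finset E, D.card = n ∧ ∀ a ∈ A, ∀ b ∈ B, ¬ N.Reaches (R ∪ ↑D) a b}

/-- The same network after its sources and its terminals have been relabelled. -/
def relabel (N : SumNetwork V E l m) (σ : Equiv.Perm (Fin l)) (τ : Equiv.Perm (Fin m)) :
    SumNetwork V E l m where
  tail := N.tail
  head := N.head
  source := N.source ∘ σ
  terminal := N.terminal ∘ τ
  source_injective := N.source_injective.comp σ.injective
  terminal_injective := N.terminal_injective.comp τ.injective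
  acyclic := N.acyclic

/-- The set of source-terminal pairs (given by their labels) that the edge `e` disconnects. -/
def disconnectedPairs (N : SumNetwork V E l m) (e : E) : Set (Fin l × Fin m) :=
  {p | N.Disconnects {e} (N.source p.1) (N.terminal p.2)}

/-- The four conditions on an edge pair, with respect to the given labelling. The sources
`s₁, s₂, s₃` are `N.source 0, N.source 1, N.source 2`, and likewise for the terminals. -/
structure IsBadPair (N : SumNetwork V E 3 3) (e₁ e₂ : E) : Prop where
  exact_left : N.disconnectedPairs e₁ = {(0, 2), (2, 0)}
  exact_right : N.disconnectedPairs e₂ = {(1, 2), (2, 1)}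
  minCut_eq_zero : N.minCut {e₁, e₂} {N.source 2} {N.terminal 2} = 0
  unreachable : ¬ N.EdgeReaches e₁ e₂ ∧ ¬ N.EdgeReaches e₂ e₁

/-- A scalar linear network code over `F`, given by its local coding coefficients. Only the
coefficients of a message or edge entering the node in question are ever used. -/
structure LinearCode (N : SumNetwork V E l m) (F : Type*) where
  /-- coefficient of the `i`-th message in the symbol sent on an edge leaving the `i`-th source -/
  messageCoeff : Fin l → E → F
  /-- coefficient of the symbol on the incoming edge (first) in that on the outgoing edge (second) -/
  edgeCoeff : E → E → F
  /-- decoding coefficient at a terminal for a message generated at the terminal itself -/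
  decodeMessageCoeff : Fin l → Fin m → F
  /-- decoding coefficient at a terminal for the symbol on an incoming edge -/
  decodeEdgeCoeff : E → Fin m → F

namespace LinearCode

variable {N : SumNetwork V E l m} {F : Type*}

/-- `y` is the assignment of symbols to the edges that the code produces from the messages `x`.
As the network is acyclic, `y` is determined by `x`. -/
def Transmits [Fintype E] [DecidableEq V] [Field F] (C : N.LinearCode F)
    (x : Fin l → F) (y : E → F) : Prop :=
  ∀ e, y e = ∑ i with N.source i = N.tail e, C.messageCoeff i e * x i +
    ∑ e' with N.head e' = N.tail e, C.edgeCoeff e' e * y e'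

/-- What the `j`-th terminal computes from the symbols it has. -/
def decode [Fintype E] [DecidableEq V] [Field F] (C : N.LinearCode F)
    (x : Fin l → F) (y : E → F) (j : Fin m) : F :=
  ∑ i with N.source i = N.terminal j, C.decodeMessageCoeff i j * x i +
    ∑ e with N.head e = N.terminal j, C.decodeEdgeCoeff e j * y e

/-- With this code every terminal recovers the sum of all messages. -/
def ComputesSum [Fintype E] [DecidableEq V] [Field F] (C : N.LinearCode F) : Prop :=
  ∀ x : Fin l → F, ∃ y : E → F, C.Transmits x y ∧ ∀ j, C.decode x y j = ∑ i, x i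

/-- An XOR code: every node, terminals included, only adds and subtracts some of the symbols that
it has. -/
structure IsXOR [Field F] (C : N.LinearCode F) : Prop where
  messageCoeff_mem : ∀ i e, C.messageCoeff i e ∈ ({0, 1, -1} : Set F)
  edgeCoeff_mem : ∀ e e', C.edgeCoeff e e' ∈ ({0, 1, -1} : Set F)
  decodeMessageCoeff_mem : ∀ i j, C.decodeMessageCoeff i j ∈ ({0, 1, -1} : Set F)
  decodeEdgeCoeff_mem : ∀ e j, C.decodeEdgeCoeff e j ∈ ({0, 1, -1} : Set F)

end LinearCode

/-- The network is solvable over `F` by an XOR network code. -/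
def XORSolvable [Fintype E] [DecidableEq V] (N : SumNetwork V E l m) (F : Type*) [Field F] :
    Prop :=
  ∃ C : N.LinearCode F, C.IsXOR ∧ C.ComputesSum

end SumNetwork

open Relation

namespace SumNetwork

/-! With indices 0, 1, 2, let messages, edges and terminal outputs be the vertices of an acyclic
relation `Feeds`. There `e` cuts the pairs (0,2) and (2,0), and `f` cuts (1,2) and (2,1). A vertex
on a path of a cut pair is comparable with the cut. As `e` and `f` are incomparable, each vertex
reached by two sources and reaching two terminals has a type k: the sources above it and the
terminals below it are exactly those other than k (`exists_hasType`).

Vertices of type 0 carry x₁+x₂, those of type 1 carry x₀+x₂, those below a single source carry its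
message, and vertices above a single terminal merely funnel symbols into it. Terminal 2 computes
(x₀+x₂)+(x₁+x₂)-x₂, with x₂ supplied by a path avoiding both cuts. Terminal 0 has x₀+x₂ and lacks
x₁, for which x₀+x₁ together with x₀ is a substitute; terminal 1 is symmetric.

Vertices of type 2 may carry x₀, x₁ or x₀+x₁. Of these three colours any two generate the third, so
a vertex seeing two colours may take any colour. Terminal 0 must see colour 1 or two colours,
terminal 1 colour 0 or two colours (`exists_serving_coloring`). If one vertex z cuts both (0,1) and
(1,0), condition (1), applied to `e`, z and to z, `f`, supplies pure x₀ at terminal 0 and pure x₁ at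
terminal 1, and all type-2 vertices carry x₀+x₁. If there is no such z and a terminal gets its
missing message directly, a constant colouring works. Otherwise colours are chosen greedily: when no
bottleneck separates the sources from either terminal, each terminal forbids at most one of three
colours at each vertex; when there is a bottleneck, the most upstream one receives the colour that
its terminal needs. -/

theorem reflTransGen_imp {I : Type*} {r q : I → I → Prop} (h : ∀ u v, r u v → q u v) {u v : I}
    (huv : ReflTransGen r u v) : ReflTransGen q u v :=
  ReflTransGen.mono h _ _ huv

theorem wellFounded_of_acyclic {I : Type*} {r : I → I → Prop} [Finite I] (hr : ∀ v, ¬ TransGen r v v) :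
    WellFounded (TransGen r) := by
  have : IsTrans I (TransGen r) := ⟨fun _ _ _ => TransGen.trans⟩
  have : Std.Irrefl (TransGen r) := ⟨hr⟩
  exact Finite.wellFounded_of_trans_of_irrefl _

/-! ### Greedy three-colourings of acyclic relations -/

section Coloring

variable {I : Type*} {r : I → I → Prop} {C Z X : Set I} {κ : I → Option (Fin 3)} {v w : I}
  {b : Fin 3}

/-- An arc to an uncoloured vertex of `C` outside `Z`. -/
def LiveStep (r : I → I → Prop) (C Z : Set I) (κ : I → Option (Fin 3)) (u v : I) : Prop :=
  r u v ∧ v ∈ C ∧ κ v = none ∧ v ∉ Z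

/-- There is a path from a vertex of colour `c` to `X` whose later vertices are uncoloured vertices
of `C` outside `Z`. -/
def Route (r : I → I → Prop) (C Z X : Set I) (κ : I → Option (Fin 3)) (c : Fin 3) : Prop :=
  ∃ p g, κ p = some c ∧ ReflTransGen (LiveStep r C Z κ) p g ∧ g ∈ X

/-- `v` is an uncoloured vertex of `C` all of whose predecessors in `C` are coloured. -/
structure Ready (r : I → I → Prop) (C : Set I) (κ : I → Option (Fin 3)) (v : I) : Prop where
  mem : v ∈ C
  uncolored : κ v = none
  colored_of_rel : ∀ u, r u v → u ∈ C → κ u ≠ none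

/-- The coloured predecessors of `v` all have colour `c`, and there is one. -/
def Mono (r : I → I → Prop) (κ : I → Option (Fin 3)) (v : I) (c : Fin 3) : Prop :=
  (∃ u, r u v ∧ κ u = some c) ∧ ∀ u d, r u v → κ u = some d → d = c

/-- Two predecessors of `v` have different colours. -/
def Free (r : I → I → Prop) (κ : I → Option (Fin 3)) (v : I) : Prop :=
  ∃ u u' d d', r u v ∧ r u' v ∧ κ u = some d ∧ κ u' = some d' ∧ d ≠ d'

/-- Every coloured vertex of `C` has a predecessor of its colour or two predecessors of different
colours. -/
def ProperOn (r : I → I → Prop) (C : Set I) (κ : I → Option (Fin 3)) : Prop :=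
  ∀ v ∈ C, ∀ c, κ v = some c → (∃ u, r u v ∧ κ u = some c) ∨ Free r κ v

theorem Route.exists_of_colored {d : Fin 3} (hC : ∀ v ∈ C, κ v ≠ none) (h : Route r C Z X κ d) :
    ∃ g ∈ X, κ g = some d := by
  obtain ⟨p, g, hp, hpg, hg⟩ := h
  rcases ReflTransGen.cases_tail hpg with h | ⟨x, -, hx⟩
  · exact ⟨g, hg, h ▸ hp⟩
  · exact absurd hx.2.2.1 (hC _ hx.2.1)

variable [DecidableEq I]

-- All predecessors of a ready `v` inside `C` are coloured, so a live path can enter `v` only in its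
-- first step. Colouring `v` thus either leaves the path alive or makes its remainder a live path
-- starting at `v`.
open Function in
theorem live_update (c : Fin 3) (hv : Ready r C κ v) {p g : I} (h : ReflTransGen (LiveStep r C Z κ) p g) :
    ReflTransGen (LiveStep r C Z (update κ v (some c))) p g ∨
      r p v ∧ ReflTransGen (LiveStep r C Z (update κ v (some c))) v g := by
  induction h with
  | refl => exact Or.inl .refl
  | @tail a g hpa hag ih =>
    obtain ⟨h1, h2, h3, h4⟩ := hag
    by_cases hg : g = v
    · subst hg
      right
      refine ⟨?_, .refl⟩
      rcases ReflTransGen.cases_tail hpa with h | ⟨x, -, hx⟩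
      · exact h ▸ h1
      · exact absurd hx.2.2.1 (hv.colored_of_rel _ h1 hx.2.1)
    · have : LiveStep r C Z (update κ v (some c)) a g :=
        ⟨h1, h2, by rw [update_of_ne hg]; exact h3, h4⟩
      rcases ih with ih | ⟨ih, ih'⟩
      · exact .inl (ih.tail this)
      · exact .inr ⟨ih, ih'.tail this⟩

open Function in
theorem liveStep_of_update {a g : I} {c : Fin 3} (h : LiveStep r C Z (update κ v (some c)) a g) :
    LiveStep r C Z κ a g ∧ g ≠ v := by
  obtain ⟨h1, h2, h3, h4⟩ := h
  have hg : g ≠ v := by rintro rfl; simp at h3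
  rw [update_of_ne hg] at h3
  exact ⟨⟨h1, h2, h3, h4⟩, hg⟩

open Function in
theorem Route.recolor (hv : Ready r C κ v) {d : Fin 3} (h : Route r C Z X κ d) (c : Fin 3) :
    Route r C Z X (update κ v (some c)) d ∨
      (∃ u, r u v ∧ κ u = some d) ∧ Route r C Z X (update κ v (some c)) c := by
  obtain ⟨p, g, hp, hpg, hg⟩ := h
  have hpv : p ≠ v := by rintro rfl; simp [hv.uncolored] at hp
  rcases live_update c hv hpg with h | ⟨h, h'⟩
  · exact .inl ⟨p, g, by rw [update_of_ne hpv]; exact hp, h, hg⟩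
  · exact .inr ⟨⟨p, h, hp⟩, v, g, by simp, h', hg⟩

open Function in
theorem Route.recolor_of_avoid (hv : Ready r C κ v) {d : Fin 3} (h : Route r C {v} X κ d)
    (c : Fin 3) : Route r C ∅ X (update κ v (some c)) d := by
  obtain ⟨p, g, hp, hpg, hg⟩ := h
  have hpv : p ≠ v := by rintro rfl; simp [hv.uncolored] at hp
  refine ⟨p, g, by rw [update_of_ne hpv]; exact hp, reflTransGen_imp ?_ hpg, hg⟩
  rintro a x ⟨h1, h2, h3, h4⟩
  exact ⟨h1, h2, by rw [update_of_ne h4]; exact h3, by simp⟩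

open Function in
theorem Route.recolor_mono {c : Fin 3} (hv : Ready r C κ v) (hm : Mono r κ v c) {d : Fin 3}
    (h : Route r C Z X κ d) : Route r C Z X (update κ v (some c)) d := by
  rcases h.recolor hv c with h | ⟨⟨u, hu, hd⟩, h⟩
  · exact h
  · exact hm.2 u d hu hd ▸ h

open Function in
/-- An invariant that colouring a vertex can destroy with one colour at most, and not with a forced
colour. -/
structure Stable (r : I → I → Prop) (C : Set I) (Inv : (I → Option (Fin 3)) → Prop) : Prop where
  mono : ∀ κ v c, Inv κ → Ready r C κ v → Mono r κ v c → Inv (update κ v (some c))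
  free : ∀ κ v, Inv κ → Ready r C κ v → ∃ b, ∀ c ≠ b, Inv (update κ v (some c))

/-- Neither a single vertex nor a single colour separates the coloured vertices from `X`. -/
def Unseparated (r : I → I → Prop) (C X : Set I) (κ : I → Option (Fin 3)) : Prop :=
  (∀ z ∈ C, ∃ c, Route r C {z} X κ c) ∧ ∀ c, ∃ d, d ≠ c ∧ Route r C ∅ X κ d

/-- The only dangerous colour for `v` is the colour `b` of some route avoiding `v`. Routes through
`v` restart at `v` with the new colour `c`, and if `c ≠ b`, the avoiding route still supplies a
colour other than `c`. -/
theorem stable_unseparated : Stable r C (Unseparated r C X) where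
  mono κ v c h hv hm :=
    ⟨fun z hz => (h.1 z hz).imp fun _ hd => hd.recolor_mono hv hm,
      fun d => (h.2 d).imp fun _ hd => ⟨hd.1, hd.2.recolor_mono hv hm⟩⟩
  free κ v h hv := by
    obtain ⟨b, hb⟩ := h.1 v hv.mem
    refine ⟨b, fun c hc => ⟨fun z hz => ?_, fun d => ?_⟩⟩
    · obtain ⟨d, hd⟩ := h.1 z hz
      rcases hd.recolor hv c with h | ⟨-, h⟩
      · exact ⟨_, h⟩
      · exact ⟨_, h⟩
    · by_cases hdc : d = c
      · exact ⟨b, hdc ▸ hc.symm, hb.recolor_of_avoid hv c⟩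
      · obtain ⟨a, ha, ha'⟩ := h.2 d
        rcases ha'.recolor hv c with h | ⟨-, h⟩
        · exact ⟨a, ha, h⟩
        · exact ⟨c, Ne.symm hdc, h⟩

theorem stable_exists_route_ne : Stable r C (fun κ => ∃ d, d ≠ b ∧ Route r C Z X κ d) where
  mono κ v c h hv hm := h.imp fun _ hd => ⟨hd.1, hd.2.recolor_mono hv hm⟩
  free κ v h hv := by
    refine ⟨b, fun c hc => ?_⟩
    obtain ⟨d, hd, hd'⟩ := h
    rcases hd'.recolor hv c with h | ⟨-, h⟩
    · exact ⟨d, hd, h⟩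
    · exact ⟨c, hc, h⟩

/-- Two invariants exclude at most two of the three colours. -/
theorem Stable.exists_and {P Q : (I → Option (Fin 3)) → Prop} (hP : Stable r C P)
    (hQ : Stable r C Q) (h : P κ ∧ Q κ) (hv : Ready r C κ v) :
    ∃ c, P (Function.update κ v (some c)) ∧ Q (Function.update κ v (some c)) := by
  obtain ⟨a, ha⟩ := hP.free κ v h.1 hv
  obtain ⟨b, hb⟩ := hQ.free κ v h.2 hv
  obtain ⟨c, hca, hcb⟩ : ∃ c : Fin 3, c ≠ a ∧ c ≠ b := by
    clear ha hb; revert a b; decide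
  exact ⟨c, ha c hca, hb c hcb⟩

open Function in
/-- Colours the vertices of a down-closed part `M` of `C` one by one. -/
theorem exists_coloring [Finite I] (hr : ∀ v, ¬ TransGen r v v)
    (Inv : (I → Option (Fin 3)) → Prop) (M : Set I) (hMC : M ⊆ C)
    (hM : ∀ u v, r u v → u ∈ C → v ∈ M → u ∈ M)
    (hmono : ∀ κ v c, Inv κ → Ready r C κ v → Mono r κ v c → Inv (update κ v (some c)))
    (hfree : ∀ κ v, Inv κ → Ready r C κ v → Free r κ v → ∃ c, Inv (update κ v (some c)))
    (κ : I → Option (Fin 3)) (hpred : ∀ v ∈ M, ∃ u, r u v ∧ (u ∈ C ∨ κ u ≠ none))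
    (hInv : Inv κ) (hκ : ProperOn r C κ) :
    ∃ κ', Inv κ' ∧ ProperOn r C κ' ∧ (∀ v ∈ M, κ' v ≠ none) ∧
      (∀ v, κ v ≠ none → κ' v = κ v) ∧ ∀ v, v ∉ M → κ' v = κ v := by
  induction hn : {v | v ∈ M ∧ κ v = none}.ncard using Nat.strong_induction_on generalizing κ with
  | _ n ih =>
  rcases Set.eq_empty_or_nonempty {v | v ∈ M ∧ κ v = none} with he | hne
  · refine ⟨κ, hInv, hκ, fun v hv h => ?_, fun _ _ => rfl, fun _ _ => rfl⟩
    exact (he.subset ⟨hv, h⟩ : v ∈ (∅ : Set I))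
  · obtain ⟨v, ⟨hvM, hv0⟩, hmin⟩ := (wellFounded_of_acyclic hr).has_min _ hne
    have hready : Ready r C κ v :=
      ⟨hMC hvM, hv0, fun u hu huC h0 => hmin u ⟨hM u v hu huC hvM, h0⟩ (.single hu)⟩
    obtain ⟨c, hc, hcI⟩ : ∃ c, ((∃ u, r u v ∧ κ u = some c) ∨ Free r κ v) ∧
        Inv (update κ v (some c)) := by
      by_cases hf : Free r κ v
      · exact (hfree κ v hInv hready hf).imp fun c h => ⟨.inr hf, h⟩
      · obtain ⟨u, hu, huc⟩ := hpred v hvM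
        have huc : κ u ≠ none := huc.elim (fun h => hready.colored_of_rel u hu h) id
        obtain ⟨c, hc⟩ := Option.ne_none_iff_exists'.mp huc
        refine ⟨c, .inl ⟨u, hu, hc⟩, hmono κ v c hInv hready ⟨⟨u, hu, hc⟩, fun x d hx hd => ?_⟩⟩
        by_contra hne
        exact hf ⟨x, u, d, c, hx, hu, hd, hc, hne⟩
    have hext : ∀ x, κ x ≠ none → update κ v (some c) x = κ x := fun x hx =>
      update_of_ne (by rintro rfl; exact hx hv0) _ _
    have hext' : ∀ x d, κ x = some d → update κ v (some c) x = some d := fun x d hx => by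
      rw [hext x (by simp [hx]), hx]
    have hfree' : ∀ x, Free r κ x → Free r (update κ v (some c)) x := by
      rintro x ⟨u, u', d, d', h1, h2, h3, h4, h5⟩
      exact ⟨u, u', d, d', h1, h2, hext' _ _ h3, hext' _ _ h4, h5⟩
    obtain ⟨κ', h1, h2, h3, h4, h5⟩ := ih ({x | x ∈ M ∧ update κ v (some c) x = none}.ncard) (by
        rw [← hn]
        refine Set.ncard_lt_ncard ⟨fun x hx => ⟨hx.1, ?_⟩, fun h => ?_⟩ (Set.toFinite _)
        · by_contra h0
          exact h0 ((hext x h0).symm.trans hx.2)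
        · have := (h ⟨hvM, hv0⟩).2
          simp at this) (update κ v (some c))
      (fun x hx => (hpred x hx).imp fun u hu => ⟨hu.1, hu.2.imp id fun h => by rwa [hext u h]⟩)
      hcI (by
        intro x hx d hd
        by_cases hxv : x = v
        · subst hxv
          obtain rfl : c = d := by simpa using hd
          exact hc.imp (fun ⟨u, hu, h⟩ => ⟨u, hu, hext' _ _ h⟩) (hfree' _)
        · rw [update_of_ne hxv] at hd
          exact (hκ x hx d hd).imp (fun ⟨u, hu, h⟩ => ⟨u, hu, hext' _ _ h⟩) (hfree' _)) rfl
    refine ⟨κ', h1, h2, h3, fun x hx => ?_, fun x hx => ?_⟩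
    · rw [h4 x (by rwa [hext x hx]), hext x hx]
    · rw [h5 x hx, update_of_ne (by rintro rfl; exact hx hvM)]

/-- `X` meets colour `c`, or it meets two different colours. -/
def Serves (κ : I → Option (Fin 3)) (X : Set I) (c : Fin 3) : Prop :=
  (∃ g ∈ X, κ g = some c) ∨
    ∃ g ∈ X, ∃ g' ∈ X, ∃ d d', κ g = some d ∧ κ g' = some d' ∧ d ≠ d'

/-- If nothing separates the coloured vertices from two sets, then both can meet two colours. -/
theorem exists_coloring_of_unseparated [Finite I] (hr : ∀ v, ¬ TransGen r v v)
    (hC : ∀ v ∈ C, κ v = none) (hpred : ∀ v ∈ C, ∃ u, r u v ∧ (u ∈ C ∨ κ u ≠ none))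
    {X Y : Set I} (hX : Unseparated r C X κ) (hY : Unseparated r C Y κ) (c d : Fin 3) :
    ∃ κ', ProperOn r C κ' ∧ (∀ v ∈ C, κ' v ≠ none) ∧ (∀ v, v ∉ C → κ' v = κ v) ∧
      Serves κ' X c ∧ Serves κ' Y d := by
  have hs := stable_unseparated (r := r) (C := C) (X := X)
  have ht := stable_unseparated (r := r) (C := C) (X := Y)
  obtain ⟨κ', ⟨h1, h2⟩, h3, h4, -, h5⟩ := exists_coloring hr
    (fun κ => Unseparated r C X κ ∧ Unseparated r C Y κ) C subset_rfl (fun _ _ _ h _ => h)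
    (fun κ v c h hv hm => ⟨hs.mono κ v c h.1 hv hm, ht.mono κ v c h.2 hv hm⟩)
    (fun κ v h hv _ => hs.exists_and ht h hv) κ hpred ⟨hX, hY⟩
    (fun v hv c h => by simp [hC v hv] at h)
  have key : ∀ X : Set I, Unseparated r C X κ' → ∀ c, Serves κ' X c := by
    intro X h c
    obtain ⟨d, -, hd⟩ := h.2 0
    obtain ⟨d', hne, hd'⟩ := h.2 d
    obtain ⟨g, hg, hgd⟩ := hd.exists_of_colored h4
    obtain ⟨g', hg', hgd'⟩ := hd'.exists_of_colored h4
    exact .inr ⟨g, hg, g', hg', d, d', hgd, hgd', hne.symm⟩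
  exact ⟨κ', h3, h4, h5, key X h1 c, key Y h2 d⟩


-- A route created by colouring `v` starts at `v`, so before the colouring every coloured
-- predecessor of `v` had a route through `v`.
open Function in
theorem Route.of_recolor (hv : Ready r C κ v) {c d : Fin 3}
    (h : Route r C ∅ X (update κ v (some c)) d) :
    Route r C ∅ X κ d ∨ d = c ∧ ∀ u e, r u v → κ u = some e → Route r C ∅ X κ e := by
  obtain ⟨p, g, hp, hpg, hg⟩ := h
  have hpg' : ReflTransGen (LiveStep r C ∅ κ) p g :=
    reflTransGen_imp (fun _ _ h => (liveStep_of_update h).1) hpg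
  by_cases hpv : p = v
  · subst hpv
    refine .inr ⟨by simpa using hp.symm, fun u e hu he => ⟨u, g, he, .head ?_ hpg', hg⟩⟩
    exact ⟨hu, hv.mem, hv.uncolored, by simp⟩
  · exact .inl ⟨p, g, by rwa [update_of_ne hpv] at hp, hpg', hg⟩

open Function in
/-- If `w` separates the coloured vertices from `X`, then `w` can be given the colour `b`, which all
paths from `w` to `X` keep, while `Y` is served with the colour `a`. -/
theorem exists_coloring_of_separated [Finite I] (hr : ∀ v, ¬ TransGen r v v)
    (hC : ∀ v ∈ C, κ v = none) (hpred : ∀ v ∈ C, ∃ u, r u v ∧ (u ∈ C ∨ κ u ≠ none))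
    {X Y : Set I} {a b : Fin 3} (hw : w ∈ C) (hcut : ∀ c, ¬ Route r C {w} X κ c)
    (hunsep : Unseparated r C {g | r g w} κ)
    (hX : ∃ g ∈ X, ReflTransGen (fun u v => r u v ∧ v ∈ C) w g)
    (hY : ∃ g ∈ Y, ReflTransGen (fun u v => r u v ∧ v ∈ C) w g)
    (hne : ∃ d, d ≠ b ∧ Route r C {w} Y κ d) :
    ∃ κ', ProperOn r C κ' ∧ (∀ v ∈ C, κ' v ≠ none) ∧ (∀ v, v ∉ C → κ' v = κ v) ∧
      Serves κ' X b ∧ Serves κ' Y a := by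
  have hs := stable_unseparated (r := r) (C := C) (X := {g | r g w})
  have ht := stable_exists_route_ne (r := r) (C := C) (X := Y) (Z := {w}) (b := b)
  -- First stage: colour only what lies strictly upstream of `w`, so that `w` ends up with
  -- predecessors of two colours while `Y` keeps a route of a colour other than `b` around `w`.
  set M : Set I := {v | v ∈ C ∧ TransGen r v w} with hMdef
  obtain ⟨κ₁, ⟨h1, h2⟩, h3, h4, h5, h6⟩ := exists_coloring hr
    (fun κ => Unseparated r C {g | r g w} κ ∧ ∃ d, d ≠ b ∧ Route r C {w} Y κ d) M
    (fun _ h => h.1) (fun u v huv hu hv => ⟨hu, .head huv hv.2⟩)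
    (fun κ v c h hv hm => ⟨hs.mono κ v c h.1 hv hm, ht.mono κ v c h.2 hv hm⟩)
    (fun κ v h hv _ => hs.exists_and ht h hv) κ (fun v hv => hpred v hv.1) ⟨hunsep, hne⟩
    (fun v hv c h => by simp [hC v hv] at h)
  have hnone : ∀ x, x ∈ C → ¬ TransGen r x w → κ₁ x = none := fun x hx hxw => by
    rw [h6 x fun h => hxw h.2, hC x hx]
  have hready : Ready r C κ₁ w :=
    ⟨hw, hnone w hw (hr w), fun u hu huC => h4 u ⟨huC, .single hu⟩⟩
  have hend : ∀ {d}, Route r C ∅ {g | r g w} κ₁ d → ∃ g, r g w ∧ κ₁ g = some d := by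
    rintro d ⟨p, g, hp, hpg, hg⟩
    rcases ReflTransGen.cases_tail hpg with h | ⟨x, -, hx⟩
    · exact ⟨g, hg, h ▸ hp⟩
    · exact absurd hx.2.2.1 (h4 g ⟨hx.2.1, .single hg⟩)
  have hfree : Free r κ₁ w := by
    obtain ⟨d, -, hd⟩ := h1.2 0
    obtain ⟨d', hdd, hd'⟩ := h1.2 d
    obtain ⟨g, hg, hgd⟩ := hend hd
    obtain ⟨g', hg', hgd'⟩ := hend hd'
    exact ⟨g, g', d, d', hg, hg', hgd, hgd', hdd.symm⟩
  set κ₂ := update κ₁ w (some b) with hκ₂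
  have hext : ∀ x d, κ₁ x = some d → κ₂ x = some d := fun x d hx => by
    rw [hκ₂, update_of_ne (by rintro rfl; simp [hready.uncolored] at hx), hx]
  have hfree' : ∀ x, Free r κ₁ x → Free r κ₂ x := by
    rintro x ⟨u, u', d, d', h1, h2, h3, h4, h5⟩
    exact ⟨u, u', d, d', h1, h2, hext _ _ h3, hext _ _ h4, h5⟩
  have hprop : ProperOn r C κ₂ := by
    intro x hx d hd
    by_cases hxw : x = w
    · exact .inr (hfree' x (hxw ▸ hfree))
    · rw [hκ₂, update_of_ne hxw] at hd
      exact (h3 x hx d hd).imp (fun ⟨u, hu, h⟩ => ⟨u, hu, hext _ _ h⟩) (hfree' _)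
  have hroute : ∀ W : Set I, (∃ g ∈ W, ReflTransGen (fun u v => r u v ∧ v ∈ C) w g) →
      Route r C ∅ W κ₂ b := by
    rintro W ⟨g, hg, hwg⟩
    refine ⟨w, g, by simp [hκ₂], ?_, hg⟩
    clear hg
    induction hwg with
    | refl => exact .refl
    | @tail y z hwy hyz ih =>
      refine ih.tail ⟨hyz.1, hyz.2, ?_, by simp⟩
      have hwz : TransGen r w z :=
        TransGen.tail' (reflTransGen_imp (fun _ _ h => h.1) hwy) hyz.1
      rw [hκ₂, update_of_ne (by rintro rfl; exact hr _ hwz)]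
      exact hnone z hyz.2 fun h => hr _ (hwz.trans h)
  -- Vertices of `M` are reachable from originally coloured ones without meeting `w`. A route from
  -- `M` to `X` around `w` would therefore extend to one that `hcut` excludes.
  have hstart : ∀ v, v ∈ M → ∃ p d, κ p = some d ∧ ReflTransGen (LiveStep r C {w} κ) p v := by
    intro v
    induction v using (wellFounded_of_acyclic hr).induction with
    | _ v ih =>
    intro hv
    obtain ⟨u, hu, huC⟩ := hpred v hv.1
    have hstep : LiveStep r C {w} κ u v :=
      ⟨hu, hv.1, hC v hv.1, by rintro rfl; exact hr _ hv.2⟩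
    rcases huC with huC | huC
    · obtain ⟨p, d, hp, hpu⟩ := ih u (.single hu) ⟨huC, .head hu hv.2⟩
      exact ⟨p, d, hp, hpu.tail hstep⟩
    · obtain ⟨d, hd⟩ := Option.ne_none_iff_exists'.mp huC
      exact ⟨u, d, hd, .single hstep⟩
  have honly : ∀ c, Route r C ∅ X κ₂ c → c = b := by
    rintro c ⟨p, g, hp, hpg, hg⟩
    by_cases hpw : p = w
    · subst hpw
      simpa [hκ₂] using hp.symm
    · have hpg : ReflTransGen (LiveStep r C {w} κ) p g := by
        refine reflTransGen_imp (fun x y h => ?_) hpg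
        exact ⟨h.1, h.2.1, hC _ h.2.1, (liveStep_of_update h).2⟩
      exfalso
      by_cases hpM : p ∈ M
      · obtain ⟨p', d, hp', hpp⟩ := hstart p hpM
        exact hcut d ⟨p', g, hp', hpp.trans hpg, hg⟩
      · rw [hκ₂, update_of_ne hpw, h6 p hpM] at hp
        exact hcut c ⟨p, g, hp, hpg, hg⟩
  obtain ⟨d, hd, hdY⟩ := h2
  -- Second stage: all routes to `X` have colour `b`. A vertex with predecessors of two colours
  -- hence lies on no live route to `X` and can safely take the colour `a` wanted by `Y`.
  obtain ⟨κ', ⟨i1, i2, i3⟩, i4, i5, -, i6⟩ := exists_coloring hr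
    (fun κ => (∀ c, Route r C ∅ X κ c → c = b) ∧ Route r C ∅ X κ b ∧
      (Route r C ∅ Y κ a ∨ ∃ d d', d ≠ d' ∧ Route r C ∅ Y κ d ∧ Route r C ∅ Y κ d'))
    C subset_rfl (fun _ _ _ h _ => h)
    (fun κ v c h hv hm => by
      refine ⟨fun e he => ?_, h.2.1.recolor_mono hv hm, ?_⟩
      · rcases he.of_recolor hv with he | ⟨rfl, he'⟩
        · exact h.1 e he
        · obtain ⟨⟨u, hu, hue⟩, -⟩ := hm
          exact h.1 _ (he' u _ hu hue)
      · exact h.2.2.imp (fun h => h.recolor_mono hv hm) fun ⟨e, e', h, h', h''⟩ =>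
          ⟨e, e', h, h'.recolor_mono hv hm, h''.recolor_mono hv hm⟩)
    (fun κ v h hv hf => by
      have honly : ∀ e, Route r C ∅ X (update κ v (some a)) e → e = b := by
        intro e he
        rcases he.of_recolor hv with he | ⟨rfl, he'⟩
        · exact h.1 e he
        · obtain ⟨u, u', d, d', hu, hu', hd, hd', hdd⟩ := hf
          exact absurd ((h.1 _ (he' u _ hu hd)).trans (h.1 _ (he' u' _ hu' hd')).symm) hdd
      refine ⟨a, honly, ?_, ?_⟩
      · rcases h.2.1.recolor hv a with h | ⟨-, h⟩
        · exact h
        · exact honly a h ▸ h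
      · rcases h.2.2 with h | ⟨e, e', hne, h, h'⟩
        · exact (h.recolor hv a).elim .inl fun h => .inl h.2
        · rcases h.recolor hv a with h | ⟨-, h⟩
          · rcases h'.recolor hv a with h' | ⟨-, h'⟩
            · exact .inr ⟨e, e', hne, h, h'⟩
            · exact .inl h'
          · exact .inl h)
    κ₂ (fun v hv => (hpred v hv).imp fun u hu => ⟨hu.1, hu.2.imp id fun h0 => by
      obtain ⟨e, he⟩ := Option.ne_none_iff_exists'.mp h0
      simp [hext u e ((h5 u h0).trans he)]⟩)
    ⟨honly, hroute X hX, .inr ⟨d, b, hd, hdY.recolor_of_avoid hready b, hroute Y hY⟩⟩ hprop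
  · refine ⟨κ', i4, i5, fun v hv => ?_, .inl (i2.exists_of_colored i5), ?_⟩
    · rw [i6 v hv, hκ₂, update_of_ne (by rintro rfl; exact hv hw), h6 v fun h => hv h.1]
    · rcases i3 with h | ⟨e, e', hne, h, h'⟩
      · exact .inl (h.exists_of_colored i5)
      · obtain ⟨g, hg, hge⟩ := h.exists_of_colored i5
        obtain ⟨g', hg', hge'⟩ := h'.exists_of_colored i5
        exact .inr ⟨g, hg, g', hg', e, e', hge, hge', hne⟩

end Coloring

/-! ### Types of vertices between the two cuts -/

section Structure

variable {I : Type*} {r : I → I → Prop} {s t : Fin 3 → I} {e f : I}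

/-- A path none of whose vertices after the first lies in `Z`. -/
def PathAvoiding (r : I → I → Prop) (Z : Set I) (u v : I) : Prop :=
  ReflTransGen (fun a b => r a b ∧ b ∉ Z) u v

theorem PathAvoiding.reaches {Z : Set I} {u v : I} (h : PathAvoiding r Z u v) :
    ReflTransGen r u v :=
  reflTransGen_imp (fun _ _ h => h.1) h

theorem PathAvoiding.of_not_reaches {u v z : I} (h : ReflTransGen r u v)
    (hz : ¬ ReflTransGen r z v) : PathAvoiding r {z} u v := by
  induction h with
  | refl => exact .refl
  | @tail a b _ hab ih =>
    exact (ih fun h => hz (h.tail hab)).tail ⟨hab, by rintro rfl; exact hz .refl⟩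

theorem PathAvoiding.of_not_reached {u v z : I} (h : ReflTransGen r u v)
    (hz : ¬ TransGen r u z) : PathAvoiding r {z} u v := by
  induction h using ReflTransGen.head_induction_on with
  | refl => exact .refl
  | @head a b hab _ ih =>
    exact .head ⟨hab, by rintro rfl; exact hz (.single hab)⟩ (ih fun h => hz (.head hab h))

/-- The vertex `e` separates `s 0` from `t 2` and `s 2` from `t 0`, and `f` separates `s 1` from
`t 2` and `s 2` from `t 1`, in a network whose vertices carry the symbols. -/
structure IsCutNetwork (r : I → I → Prop) (s t : Fin 3 → I) (e f : I) : Prop where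
  acyclic : ∀ v, ¬ TransGen r v v
  source_injective : Function.Injective s
  terminal_injective : Function.Injective t
  not_rel_source : ∀ u i, ¬ r u (s i)
  not_terminal_rel : ∀ j v, ¬ r (t j) v
  connected : ∀ i j, ReflTransGen r (s i) (t j)
  cut_left : ¬ PathAvoiding r {e} (s 0) (t 2) ∧ ¬ PathAvoiding r {e} (s 2) (t 0)
  cut_right : ¬ PathAvoiding r {f} (s 1) (t 2) ∧ ¬ PathAvoiding r {f} (s 2) (t 1)
  not_reaches : ¬ ReflTransGen r e f ∧ ¬ ReflTransGen r f e

/-- `v` reaches at least two terminals. -/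
def IsShared (r : I → I → Prop) (t : Fin 3 → I) (v : I) : Prop :=
  ∃ j j', j ≠ j' ∧ ReflTransGen r v (t j) ∧ ReflTransGen r v (t j')

/-- The sources that reach `v`, and the terminals that `v` reaches, are those other than the
`k`-th. -/
def HasType (r : I → I → Prop) (s t : Fin 3 → I) (k : Fin 3) (v : I) : Prop :=
  ∀ i, (ReflTransGen r (s i) v ↔ i ≠ k) ∧ (ReflTransGen r v (t i) ↔ i ≠ k)

/-- The vertices that reach several terminals and have a successor that reaches only the `j`-th. -/
def exits (r : I → I → Prop) (t : Fin 3 → I) (j : Fin 3) : Set I :=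
  {g | IsShared r t g ∧ ∃ x, r g x ∧ ∀ k, ReflTransGen r x (t k) ↔ k = j}

theorem IsShared.of_reaches {u v : I} (hv : IsShared r t v) (h : ReflTransGen r u v) :
    IsShared r t u := by
  obtain ⟨j, j', hne, h1, h2⟩ := hv
  exact ⟨j, j', hne, h.trans h1, h.trans h2⟩

theorem eq_of_ne_of_ne {i j k l : Fin 3} (h₁ : i ≠ j) (h₂ : i ≠ k) (h₃ : j ≠ k) (h₄ : i ≠ l)
    (h₅ : j ≠ l) : l = k := by
  omega

theorem exists_two (k : Fin 3) : ∃ i j : Fin 3, i ≠ j ∧ i ≠ k ∧ j ≠ k := by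
  revert k; decide

theorem HasType.isShared {k : Fin 3} {v : I} (h : HasType r s t k v) : IsShared r t v := by
  obtain ⟨i, j, hij, hi, hj⟩ := exists_two k
  exact ⟨i, j, hij, (h i).2.2 hi, (h j).2.2 hj⟩

theorem reaches_or_reached_of_cut {z v u w : I} (hz : ¬ PathAvoiding r {z} u w)
    (hu : ReflTransGen r u v) (hw : ReflTransGen r v w) :
    ReflTransGen r z v ∨ ReflTransGen r v z := by
  by_contra! h
  exact hz ((PathAvoiding.of_not_reaches hu h.1).trans
    (PathAvoiding.of_not_reached hw fun h' => h.2 h'.to_reflTransGen))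

theorem reaches_of_cut {z u w : I} (hz : ¬ PathAvoiding r {z} u w) (h : ReflTransGen r u w) :
    ReflTransGen r u z ∧ ReflTransGen r z w := by
  constructor
  · by_contra h'
    exact hz (.of_not_reached h fun h => h' h.to_reflTransGen)
  · by_contra h'
    exact hz (.of_not_reaches h h')

namespace IsCutNetwork

variable (N : IsCutNetwork r s t e f)
include N

/-- The cut pairs put `e` below `s 0`, `s 2` and above `t 0`, `t 2`. Were it below `s 1` or above `t
1`, it would lie on a path of a pair cut by `f` and be comparable with `f`. -/
theorem hasType_left : HasType r s t 1 e := by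
  obtain ⟨h1, h2⟩ := reaches_of_cut N.cut_left.1 (N.connected 0 2)
  obtain ⟨h3, h4⟩ := reaches_of_cut N.cut_left.2 (N.connected 2 0)
  have h5 : ¬ ReflTransGen r (s 1) e := fun h =>
    (reaches_or_reached_of_cut N.cut_right.1 h h2).elim N.not_reaches.2 N.not_reaches.1
  have h6 : ¬ ReflTransGen r e (t 1) := fun h =>
    (reaches_or_reached_of_cut N.cut_right.2 h3 h).elim N.not_reaches.2 N.not_reaches.1
  intro i
  fin_cases i <;> simp [h1, h2, h3, h4, h5, h6]

theorem hasType_right : HasType r s t 0 f := by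
  obtain ⟨h1, h2⟩ := reaches_of_cut N.cut_right.1 (N.connected 1 2)
  obtain ⟨h3, h4⟩ := reaches_of_cut N.cut_right.2 (N.connected 2 1)
  have h5 : ¬ ReflTransGen r (s 0) f := fun h =>
    (reaches_or_reached_of_cut N.cut_left.1 h h2).elim N.not_reaches.1 N.not_reaches.2
  have h6 : ¬ ReflTransGen r f (t 0) := fun h =>
    (reaches_or_reached_of_cut N.cut_left.2 h3 h).elim N.not_reaches.1 N.not_reaches.2
  intro i
  fin_cases i <;> simp [h1, h2, h3, h4, h5, h6]

theorem hasType_of_comparable_left {v : I} (hv : ReflTransGen r e v ∨ ReflTransGen r v e)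
    (hS : ∃ i j, i ≠ j ∧ ReflTransGen r (s i) v ∧ ReflTransGen r (s j) v)
    (hT : IsShared r t v) : HasType r s t 1 v := by
  have he := N.hasType_left
  have hf := N.hasType_right
  have e0 := (he 0).1.2 (by decide)
  have e2 := (he 2).1.2 (by decide)
  have e0' := (he 0).2.2 (by decide)
  have e2' := (he 2).2.2 (by decide)
  rcases hv with hv | hv
  · have h1 : ¬ ReflTransGen r v (t 1) := fun h => (he 1).2.1 (hv.trans h) rfl
    have h0 : ReflTransGen r v (t 0) ∧ ReflTransGen r v (t 2) := by
      obtain ⟨i, j, hij, hi, hj⟩ := hT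
      fin_cases i <;> fin_cases j <;> simp_all
    have h2 : ¬ ReflTransGen r (s 1) v := fun h => by
      rcases reaches_or_reached_of_cut N.cut_right.1 h h0.2 with h' | h'
      · exact (hf 0).2.1 (h'.trans h0.1) rfl
      · exact N.not_reaches.1 (hv.trans h')
    intro i
    fin_cases i <;> simp [h0, h1, h2, e0.trans hv, e2.trans hv]
  · have h1 : ¬ ReflTransGen r (s 1) v := fun h => (he 1).1.1 (h.trans hv) rfl
    have h0 : ReflTransGen r (s 0) v ∧ ReflTransGen r (s 2) v := by
      obtain ⟨i, j, hij, hi, hj⟩ := hS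
      fin_cases i <;> fin_cases j <;> simp_all
    have h2 : ¬ ReflTransGen r v (t 1) := fun h => by
      rcases reaches_or_reached_of_cut N.cut_right.2 h0.2 h with h' | h'
      · exact N.not_reaches.2 (h'.trans hv)
      · exact (hf 0).1.1 (h0.1.trans h') rfl
    intro i
    fin_cases i <;> simp [h0, h1, h2, hv.trans e0', hv.trans e2']

theorem hasType_of_comparable_right {v : I} (hv : ReflTransGen r f v ∨ ReflTransGen r v f)
    (hS : ∃ i j, i ≠ j ∧ ReflTransGen r (s i) v ∧ ReflTransGen r (s j) v)
    (hT : IsShared r t v) : HasType r s t 0 v := by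
  have he := N.hasType_left
  have hf := N.hasType_right
  have f1 := (hf 1).1.2 (by decide)
  have f2 := (hf 2).1.2 (by decide)
  have f1' := (hf 1).2.2 (by decide)
  have f2' := (hf 2).2.2 (by decide)
  rcases hv with hv | hv
  · have h1 : ¬ ReflTransGen r v (t 0) := fun h => (hf 0).2.1 (hv.trans h) rfl
    have h0 : ReflTransGen r v (t 1) ∧ ReflTransGen r v (t 2) := by
      obtain ⟨i, j, hij, hi, hj⟩ := hT
      fin_cases i <;> fin_cases j <;> simp_all
    have h2 : ¬ ReflTransGen r (s 0) v := fun h => by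
      rcases reaches_or_reached_of_cut N.cut_left.1 h h0.2 with h' | h'
      · exact (he 1).2.1 (h'.trans h0.1) rfl
      · exact N.not_reaches.2 (hv.trans h')
    intro i
    fin_cases i <;> simp [h0, h1, h2, f1.trans hv, f2.trans hv]
  · have h1 : ¬ ReflTransGen r (s 0) v := fun h => (hf 0).1.1 (h.trans hv) rfl
    have h0 : ReflTransGen r (s 1) v ∧ ReflTransGen r (s 2) v := by
      obtain ⟨i, j, hij, hi, hj⟩ := hS
      fin_cases i <;> fin_cases j <;> simp_all
    have h2 : ¬ ReflTransGen r v (t 0) := fun h => by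
      rcases reaches_or_reached_of_cut N.cut_left.2 h0.2 h with h' | h'
      · exact N.not_reaches.1 (h'.trans hv)
      · exact (he 1).1.1 (h0.1.trans h') rfl
    intro i
    fin_cases i <;> simp [h0, h1, h2, hv.trans f1', hv.trans f2']

/-- A vertex comparable with `e` or `f` inherits the type of that cut. Any other vertex lies on no
path of the four cut pairs, which excludes `s 2` above it and `t 2` below it. -/
theorem exists_hasType {v : I}
    (hS : ∃ i j, i ≠ j ∧ ReflTransGen r (s i) v ∧ ReflTransGen r (s j) v)
    (hT : IsShared r t v) : ∃ k, HasType r s t k v := by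
  by_cases he : ReflTransGen r e v ∨ ReflTransGen r v e
  · exact ⟨1, N.hasType_of_comparable_left he hS hT⟩
  by_cases hf : ReflTransGen r f v ∨ ReflTransGen r v f
  · exact ⟨0, N.hasType_of_comparable_right hf hS hT⟩
  have h1 := fun a b => he (reaches_or_reached_of_cut (v := v) N.cut_left.1 a b)
  have h2 := fun a b => he (reaches_or_reached_of_cut (v := v) N.cut_left.2 a b)
  have h3 := fun a b => hf (reaches_or_reached_of_cut (v := v) N.cut_right.1 a b)
  have h4 := fun a b => hf (reaches_or_reached_of_cut (v := v) N.cut_right.2 a b)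
  refine ⟨2, ?_⟩
  have key : (ReflTransGen r (s 0) v ∧ ReflTransGen r (s 1) v ∧ ¬ ReflTransGen r (s 2) v) ∧
      ReflTransGen r v (t 0) ∧ ReflTransGen r v (t 1) ∧ ¬ ReflTransGen r v (t 2) := by
    obtain ⟨i, j, hij, hi, hj⟩ := hS
    obtain ⟨k, l, hkl, hk, hl⟩ := hT
    fin_cases i <;> fin_cases j <;> fin_cases k <;> fin_cases l <;> simp at hij hkl hi hj hk hl <;>
      tauto
  intro i
  fin_cases i <;> simp [key]

/-- The exit is the last vertex of the path that reaches several terminals. The subrelation `q`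
records which vertices the path avoids. -/
theorem exists_exit {q : I → I → Prop} (hq : ∀ u v, q u v → r u v) {v : I} {j : Fin 3}
    (hv : IsShared r t v) (h : ReflTransGen q v (t j)) :
    ∃ g ∈ exits r t j, ReflTransGen q v g ∧ ReflTransGen q g (t j) := by
  induction h using ReflTransGen.head_induction_on with
  | refl =>
    obtain ⟨k, l, hkl, hk, hl⟩ := hv
    have : ∀ k, ReflTransGen r (t j) (t k) → k = j := fun k hk => by
      rcases ReflTransGen.cases_head hk with h | ⟨c, h, -⟩
      · exact N.terminal_injective h.symm
      · exact absurd h (N.not_terminal_rel _ _)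
    exact absurd ((this k hk).trans (this l hl).symm) hkl
  | @head a b hab hb ih =>
    by_cases hs : IsShared r t b
    · obtain ⟨g, hg, h1, h2⟩ := ih hs
      exact ⟨g, hg, .head hab h1, h2⟩
    · refine ⟨a, ⟨hv, b, hq _ _ hab, fun k => ⟨fun hk => ?_, ?_⟩⟩, .refl, .head hab hb⟩
      · by_contra hkj
        exact hs ⟨k, j, hkj, hk, reflTransGen_imp hq hb⟩
      · rintro rfl
        exact reflTransGen_imp hq hb

theorem isShared_source (i : Fin 3) : IsShared r t (s i) :=
  ⟨0, 1, by decide, N.connected i 0, N.connected i 1⟩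

theorem source_reaches_source {i j : Fin 3} : ReflTransGen r (s i) (s j) ↔ i = j := by
  refine ⟨fun h => ?_, fun h => h ▸ .refl⟩
  rcases ReflTransGen.cases_tail h with h | ⟨c, -, h⟩
  · exact N.source_injective h.symm
  · exact absurd h (N.not_rel_source _ _)

theorem hasType_of_reached {u v : I} {k : Fin 3} (hu : HasType r s t k u)
    (h : ReflTransGen r u v) (hv : IsShared r t v) : HasType r s t k v := by
  obtain ⟨i, j, hij, hi, hj⟩ := exists_two k
  have hi' := ((hu i).1.2 hi).trans h
  have hj' := ((hu j).1.2 hj).trans h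
  obtain ⟨l, hl⟩ := N.exists_hasType ⟨i, j, hij, hi', hj'⟩ hv
  have h1 := (hl i).1.1 hi'
  have : l = k := eq_of_ne_of_ne hij hi hj h1 ((hl j).1.1 hj')
  exact this ▸ hl

theorem exists_exit_hasType {u : I} {j k : Fin 3} (hu : HasType r s t k u) (hj : j ≠ k) :
    ∃ g ∈ exits r t j, HasType r s t k g ∧ ReflTransGen r u g := by
  obtain ⟨g, hg, h, -⟩ := N.exists_exit (fun _ _ h => h) hu.isShared ((hu j).2.2 hj)
  exact ⟨g, hg, N.hasType_of_reached hu h hg.1, h⟩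

/-- If every pair of cuts `(i, k)`, `(k, i)` is made by a vertex of `Z` that some path from `s i` to
`t i` avoids, then the symbol of `s i` can be had, unmixed, next to the vertices that only reach
`t i`. -/
theorem exists_pure_exit {Z : Set I} {i : Fin 3} (h : PathAvoiding r Z (s i) (t i))
    (hZ : ∀ k ≠ i, ∃ z ∈ Z, ¬ PathAvoiding r {z} (s i) (t k) ∧ ¬ PathAvoiding r {z} (s k) (t i)) :
    ∃ g ∈ exits r t i, ∀ k, ReflTransGen r (s k) g ↔ k = i := by
  obtain ⟨g, hg, h1, h2⟩ := N.exists_exit (q := fun a b => r a b ∧ b ∉ Z) (fun _ _ h => h.1)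
    (N.isShared_source i) h
  have hgi : ReflTransGen r (s i) g := PathAvoiding.reaches h1
  refine ⟨g, hg, fun k => ⟨fun hk => ?_, by rintro rfl; exact hgi⟩⟩
  by_contra hki
  -- A second source `s k` above `g` forces a type, so `g` also reaches `t k`. The cut of `(i, k)`
  -- must then lie strictly below `g`, and going from `s k` through `g` to `t i` avoids it.
  obtain ⟨l, hl⟩ := N.exists_hasType ⟨k, i, hki, hk, hgi⟩ hg.1
  have hkt := (hl k).2.2 ((hl k).1.1 hk)
  obtain ⟨z, hz, hz1, hz2⟩ := hZ k hki
  have hsub : ∀ {u v}, ReflTransGen (fun a b => r a b ∧ b ∉ Z) u v → PathAvoiding r {z} u v :=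
    reflTransGen_imp fun _ _ h => ⟨h.1, fun h' => h.2 ((Set.mem_singleton_iff.1 h') ▸ hz)⟩
  have hgz : TransGen r g z := by
    by_contra h'
    exact hz1 ((hsub h1).trans (PathAvoiding.of_not_reached hkt h'))
  exact hz2 ((PathAvoiding.of_not_reaches hk fun h' => N.acyclic g (hgz.trans_left h')).trans
    (hsub h2))

end IsCutNetwork

end Structure

/-! ### Colouring the vertices of type 2 -/

section Colors

variable {I : Type*} {r : I → I → Prop} {s t : Fin 3 → I} {e f : I}

open Classical in
/-- The colour `i` at the vertices that only `s i` reaches, where `i ≠ 2`. -/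
noncomputable def sourceColor (r : I → I → Prop) (s t : Fin 3 → I) (v : I) : Option (Fin 3) :=
  if IsShared r t v ∧ ∀ k, ReflTransGen r (s k) v ↔ k = 0 then some 0
  else if IsShared r t v ∧ ∀ k, ReflTransGen r (s k) v ↔ k = 1 then some 1
  else none

theorem sourceColor_eq_some {v : I} {i : Fin 3} : sourceColor r s t v = some i ↔
    i ≠ 2 ∧ IsShared r t v ∧ ∀ k, ReflTransGen r (s k) v ↔ k = i := by
  unfold sourceColor
  split_ifs with h0 h1
  · constructor
    · rintro h
      obtain rfl : 0 = i := by simpa using h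
      exact ⟨by decide, h0⟩
    · rintro ⟨-, -, h⟩
      rw [(h 0).1 ((h0.2 0).2 rfl)]
  · constructor
    · rintro h
      obtain rfl : 1 = i := by simpa using h
      exact ⟨by decide, h1⟩
    · rintro ⟨-, -, h⟩
      rw [(h 1).1 ((h1.2 1).2 rfl)]
  · simp only [false_iff]
    rintro ⟨hi, h⟩
    fin_cases i
    · exact h0 h
    · exact h1 h
    · exact hi rfl

theorem HasType.sourceColor_eq_none {v : I} (hv : HasType r s t 2 v) :
    sourceColor r s t v = none := by
  by_contra h
  obtain ⟨i, hi⟩ := Option.ne_none_iff_exists'.mp h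
  obtain ⟨-, -, h⟩ := sourceColor_eq_some.1 hi
  exact absurd (((h 0).1 ((hv 0).1.2 (by decide))).trans
    ((h 1).1 ((hv 1).1.2 (by decide))).symm) (by decide)

theorem live_avoid {C : Set I} {κ : I → Option (Fin 3)} {Z : Set I} {p g z : I}
    (h : ReflTransGen (LiveStep r C Z κ) p g) :
    ReflTransGen (LiveStep r C {z} κ) p g ∨
      ReflTransGen r z g ∧ ∃ y, ReflTransGen (LiveStep r C Z κ) p y ∧ r y z := by
  induction h with
  | refl => exact .inl .refl
  | @tail a b hpa hab ih =>
    rcases ih with ih | ⟨h, h'⟩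
    · by_cases hb : b = z
      · subst hb
        exact .inr ⟨.refl, a, hpa, hab.1⟩
      · exact .inl (ih.tail ⟨hab.1, hab.2.1, hab.2.2.1, hb⟩)
    · exact .inr ⟨h.tail hab.1, h'⟩

namespace IsCutNetwork

variable (N : IsCutNetwork r s t e f)
include N

theorem sourceColor_or_hasType {v : I} (hv : IsShared r t v) {i : Fin 3} (hi : i ≠ 2)
    (h : ReflTransGen r (s i) v) (h2 : ¬ ReflTransGen r (s 2) v) :
    v ∈ {v | HasType r s t 2 v} ∨ sourceColor r s t v = some i := by
  by_cases hJ : ∃ j, i ≠ j ∧ ReflTransGen r (s j) v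
  · obtain ⟨j, hij, hj⟩ := hJ
    obtain ⟨k, hk⟩ := N.exists_hasType ⟨i, j, hij, h, hj⟩ hv
    have : k = 2 := by
      by_contra hk2
      exact h2 ((hk 2).1.2 (Ne.symm hk2))
    exact .inl (this ▸ hk)
  · push Not at hJ
    refine .inr (sourceColor_eq_some.2 ⟨hi, hv, fun k => ⟨fun hk => ?_, by rintro rfl; exact h⟩⟩)
    by_contra hki
    exact hJ k (Ne.symm hki) hk

theorem rel_hasType {u v : I} (huv : r u v) (hv : HasType r s t 2 v) {i : Fin 3}
    (h : ReflTransGen r (s i) u) :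
    u ∈ {v | HasType r s t 2 v} ∨ sourceColor r s t u = some i :=
  N.sourceColor_or_hasType (hv.isShared.of_reaches (.single huv))
    ((hv i).1.1 (h.tail huv)) h fun h2 => (hv 2).1.1 (h2.tail huv) rfl

theorem exists_rel_hasType {v : I} (hv : HasType r s t 2 v) {i : Fin 3} (hi : i ≠ 2) :
    ∃ u, r u v ∧ (u ∈ {v | HasType r s t 2 v} ∨ sourceColor r s t u = some i) := by
  rcases ReflTransGen.cases_tail ((hv i).1.2 hi) with h | ⟨u, h, huv⟩
  · obtain ⟨j, hj, hj2⟩ : ∃ j, j ≠ i ∧ j ≠ 2 := by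
      clear h; revert i; decide
    have := (hv j).1.2 hj2
    rw [h, N.source_reaches_source] at this
    exact absurd this hj
  · exact ⟨u, huv, N.rel_hasType huv hv h⟩

/-- Going back along the path from a type-2 vertex, one stays among type-2 vertices until the first
vertex that only `s i` reaches; the live path starts there. -/
theorem exists_live {Z : Set I} {g : I} {i : Fin 3} (h : PathAvoiding r Z (s i) g)
    (hg : g ∈ {v | HasType r s t 2 v} ∨ sourceColor r s t g = some i) :
    ∃ p, sourceColor r s t p = some i ∧
      ReflTransGen (LiveStep r {v | HasType r s t 2 v} Z (sourceColor r s t)) p g := by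
  have key : ∀ g, sourceColor r s t g = some i → ∃ p, sourceColor r s t p = some i ∧
      ReflTransGen (LiveStep r {v | HasType r s t 2 v} Z (sourceColor r s t)) p g :=
    fun g hg => ⟨g, hg, .refl⟩
  induction h with
  | refl =>
    rcases hg with hg | hg
    · refine key _ (sourceColor_eq_some.2 ⟨(hg i).1.1 .refl, hg.isShared, fun k => ?_⟩)
      rw [N.source_reaches_source]
    · exact key _ hg
  | @tail a b ha hab ih =>
    rcases hg with hg | hg
    · obtain ⟨p, hp, hpa⟩ := ih (N.rel_hasType hab.1 hg (PathAvoiding.reaches ha))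
      exact ⟨p, hp, hpa.tail ⟨hab.1, hg, HasType.sourceColor_eq_none hg, hab.2⟩⟩
    · exact key _ hg

/-- If `s 2` also reached the exit, its type would have to be `j`, although it reaches `t j`. -/
theorem exists_exit_of_path {q : I → I → Prop} (hq : ∀ u v, q u v → r u v) {i j : Fin 3}
    (hij : i ≠ j) (hi : i ≠ 2) (hj : j ≠ 2) (h : ReflTransGen q (s i) (t j)) :
    ∃ g ∈ exits r t j, ReflTransGen q (s i) g ∧
      (g ∈ {v | HasType r s t 2 v} ∨ sourceColor r s t g = some i) := by
  obtain ⟨g, hg, h1, h2⟩ := N.exists_exit hq (N.isShared_source i) h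
  have h1' := reflTransGen_imp hq h1
  have h2' := reflTransGen_imp hq h2
  refine ⟨g, hg, h1, N.sourceColor_or_hasType hg.1 hi h1' fun h3 => ?_⟩
  obtain ⟨k, hk⟩ := N.exists_hasType ⟨i, 2, hi, h1', h3⟩ hg.1
  exact (hk j).2.1 h2' (eq_of_ne_of_ne hi hij (Ne.symm hj) ((hk i).1.1 h1')
    ((hk 2).1.1 h3)).symm

theorem path_hasType {u v : I} (hu : HasType r s t 2 u) (hv : HasType r s t 2 v)
    (h : ReflTransGen r u v) :
    ReflTransGen (fun a b => r a b ∧ b ∈ {v | HasType r s t 2 v}) u v := by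
  induction h using ReflTransGen.head_induction_on with
  | refl => exact .refl
  | @head a b hab hb ih =>
    have := N.hasType_of_reached hu (.single hab) (hv.isShared.of_reaches hb)
    exact .head ⟨hab, this⟩ (ih this)

open Classical in
/-- All vertices that mix the first two symbols may carry the same combination. -/
theorem exists_constant_coloring (c : Fin 3) :
    ∃ κ, ProperOn r {v | HasType r s t 2 v} κ ∧ (∀ v, HasType r s t 2 v → κ v = some c) ∧
      ∀ v, v ∉ {v | HasType r s t 2 v} → κ v = sourceColor r s t v := by
  refine ⟨fun v => if HasType r s t 2 v then some c else sourceColor r s t v, ?_, ?_, ?_⟩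
  · intro v hv d hd
    replace hv : HasType r s t 2 v := hv
    obtain rfl : c = d := by simpa [hv] using hd
    have key : ∀ i : Fin 3, i ≠ 2 → ∃ u, r u v ∧
        ((if HasType r s t 2 u then some c else sourceColor r s t u) = some c ∨
        (if HasType r s t 2 u then some c else sourceColor r s t u) = some i) := by
      intro i hi
      obtain ⟨u, huv, hu⟩ := N.exists_rel_hasType hv hi
      refine ⟨u, huv, ?_⟩
      by_cases hu2 : HasType r s t 2 u
      · simp [hu2]
      · simpa [hu2] using .inr (hu.resolve_left hu2)
    by_cases hex : ∃ u, r u v ∧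
        (if HasType r s t 2 u then some c else sourceColor r s t u) = some c
    · exact .inl hex
    · push Not at hex
      obtain ⟨u, hu, hu0⟩ := key 0 (by decide)
      obtain ⟨u', hu', hu1⟩ := key 1 (by decide)
      exact .inr ⟨u, u', 0, 1, hu, hu', hu0.resolve_left (hex u hu),
        hu1.resolve_left (hex u' hu'), by decide⟩
  · intro v hv
    simp [hv]
  · intro v hv
    exact if_neg hv

/-- One exit already supplies colour `i` towards `t j`, so every type-2 vertex can take colour `j`,
which is what `t i` needs. -/
theorem exists_coloring_of_direct {i j : Fin 3} (hij : i ≠ j) (hi : i ≠ 2) (hj : j ≠ 2)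
    (hdir : ∃ g ∈ exits r t j, sourceColor r s t g = some i) :
    ∃ κ, ProperOn r {v | HasType r s t 2 v} κ ∧ (∀ v, HasType r s t 2 v → κ v ≠ none) ∧
      (∀ v, v ∉ {v | HasType r s t 2 v} → κ v = sourceColor r s t v) ∧
      Serves κ (exits r t j) i ∧ Serves κ (exits r t i) j := by
  obtain ⟨κ, h1, h2, h3⟩ := N.exists_constant_coloring j
  have hsc : ∀ v k, sourceColor r s t v = some k → κ v = some k := fun v k h => by
    rw [h3 v fun hv => by simp [HasType.sourceColor_eq_none hv] at h, h]
  refine ⟨κ, h1, fun v hv => by simp [h2 v hv], h3, .inl ?_, .inl ?_⟩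
  · exact hdir.imp fun g hg => ⟨hg.1, hsc g i hg.2⟩
  · obtain ⟨g, hg, -, h⟩ := N.exists_exit_of_path (fun _ _ h => h) hij.symm hj hi (N.connected j i)
    exact ⟨g, hg, h.elim (h2 g) (hsc g j)⟩

theorem route_of_path {Z X : Set I} {g : I} {i : Fin 3} (h : PathAvoiding r Z (s i) g)
    (hg : g ∈ {v | HasType r s t 2 v} ∨ sourceColor r s t g = some i) (hX : g ∈ X) :
    Route r {v | HasType r s t 2 v} Z X (sourceColor r s t) i := by
  obtain ⟨p, hp, hpg⟩ := N.exists_live h hg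
  exact ⟨p, g, hp, hpg, hX⟩

-- Routes of both source colours exist, so the separation is due to a single vertex. A most upstream
-- separating vertex `w` has unseparated predecessors, as needed for `exists_coloring_of_separated`.
open Classical in
theorem exists_coloring_of_not_unseparated [Finite I] {i j : Fin 3} (hij : i ≠ j) (hi : i ≠ 2)
    (hj : j ≠ 2) (hdir : ∀ g ∈ exits r t j, sourceColor r s t g ≠ some i)
    (hcut : ∀ z, PathAvoiding r {z} (s i) (t j) ∨ PathAvoiding r {z} (s j) (t i))
    (hsep : ¬ Unseparated r {v | HasType r s t 2 v} (exits r t j) (sourceColor r s t)) :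
    ∃ κ, ProperOn r {v | HasType r s t 2 v} κ ∧ (∀ v, HasType r s t 2 v → κ v ≠ none) ∧
      (∀ v, v ∉ {v | HasType r s t 2 v} → κ v = sourceColor r s t v) ∧
      Serves κ (exits r t j) i ∧ Serves κ (exits r t i) j := by
  have hempty : ∀ {u v}, ReflTransGen r u v → PathAvoiding r ∅ u v :=
    reflTransGen_imp fun _ _ h => ⟨h, by simp⟩
  have hroutes : ∀ {X : Set I}, (∃ g ∈ X, HasType r s t 2 g) → ∀ k, k ≠ 2 →
      Route r {v | HasType r s t 2 v} ∅ X (sourceColor r s t) k := by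
    rintro X ⟨g, hgX, hg⟩ k hk
    exact N.route_of_path (hempty ((hg k).1.2 hk)) (.inl hg) hgX
  have hother : ∀ c : Fin 3, ∃ d, d ≠ c ∧ d ≠ 2 := by decide
  obtain ⟨z, hz, hzX⟩ : ∃ z, HasType r s t 2 z ∧
      ∀ c, ¬ Route r {v | HasType r s t 2 v} {z} (exits r t j) (sourceColor r s t) c := by
    by_contra! h
    refine hsep ⟨h, fun c => ?_⟩
    obtain ⟨d, hdc, hd⟩ := hother c
    obtain ⟨g, hg, -, hg'⟩ := N.exists_exit_of_path (fun _ _ h => h) hij hi hj (N.connected i j)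
    exact ⟨d, hdc, hroutes ⟨g, hg, hg'.resolve_right (hdir g hg)⟩ d hd⟩
  obtain ⟨w, ⟨hw, hwX⟩, hmin⟩ := (wellFounded_of_acyclic N.acyclic).has_min
    {z | HasType r s t 2 z ∧
      ∀ c, ¬ Route r {v | HasType r s t 2 v} {z} (exits r t j) (sourceColor r s t) c} ⟨z, hz, hzX⟩
  have hto : ∀ k, k ≠ 2 →
      Route r {v | HasType r s t 2 v} ∅ {g | r g w} (sourceColor r s t) k := by
    intro k hk
    obtain ⟨p, hp, hpw⟩ := N.exists_live (hempty ((hw k).1.2 hk)) (.inl hw)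
    rcases ReflTransGen.cases_tail hpw with h | ⟨y, h, hy⟩
    · rw [← h, HasType.sourceColor_eq_none hw] at hp
      simp at hp
    · exact ⟨p, y, hp, h, hy.1⟩
  refine exists_coloring_of_separated (w := w) N.acyclic (fun v hv => HasType.sourceColor_eq_none hv)
    (fun v hv => (N.exists_rel_hasType hv hi).imp fun u hu => ⟨hu.1, hu.2.imp id
      fun h => by simp [h]⟩) hw hwX ⟨fun z hz => ?_, fun c => ?_⟩ ?_ ?_ ⟨j, hij.symm, ?_⟩
  -- A vertex `z` separating the sources from the predecessors of `w` lies strictly upstream of `w`.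
  -- It also separates them from the exits, since every route there meets `w`; this contradicts
  -- minimality.
  · by_contra! hzw
    obtain ⟨p, g, hp, hpg, hg⟩ := hto i hi
    rcases live_avoid (z := z) hpg with h | ⟨h, -⟩
    · exact hzw i ⟨p, g, hp, h, hg⟩
    · refine hmin z ⟨hz, fun c hc => ?_⟩ (.tail' h hg)
      obtain ⟨p', g', hp', hpg', hg'⟩ := hc
      rcases live_avoid (z := w) hpg' with h | ⟨-, y, hy, hyw⟩
      · exact hwX c ⟨p', g', hp', h, hg'⟩
      · exact hzw c ⟨p', y, hp', hy, hyw⟩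
  · obtain ⟨d, hdc, hd⟩ := hother c
    exact ⟨d, hdc, hto d hd⟩
  · obtain ⟨g, hg, hg2, hwg⟩ := N.exists_exit_hasType hw hj
    exact ⟨g, hg, N.path_hasType hw hg2 hwg⟩
  · obtain ⟨g, hg, hg2, hwg⟩ := N.exists_exit_hasType hw hi
    exact ⟨g, hg, N.path_hasType hw hg2 hwg⟩
  -- A path from `s i` to `t j` around `w` is impossible, so one leads from `s j` to `t i` around
  -- `w` and brings colour `j` there.
  · rcases hcut w with h | h
    · obtain ⟨g, hg, h1, h2⟩ := N.exists_exit_of_path (fun _ _ h => h.1) hij hi hj h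
      exact absurd (N.route_of_path h1 h2 hg) (hwX i)
    · obtain ⟨g, hg, h1, h2⟩ := N.exists_exit_of_path (fun _ _ h => h.1) hij.symm hj hi h
      exact N.route_of_path h1 h2 hg

/-- The vertices mixing the first two symbols can be coloured such that `t 0` and `t 1` are
served. -/
theorem exists_serving_coloring [Finite I]
    (hcut : ∀ z, ¬ PathAvoiding r {z} (s 0) (t 1) → ¬ PathAvoiding r {z} (s 1) (t 0) →
      PathAvoiding r {e, z} (s 0) (t 0) ∧ PathAvoiding r {f, z} (s 1) (t 1)) :
    ∃ κ, ProperOn r {v | HasType r s t 2 v} κ ∧ (∀ v, HasType r s t 2 v → κ v ≠ none) ∧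
      (∀ v, v ∉ {v | HasType r s t 2 v} → κ v = sourceColor r s t v) ∧
      Serves κ (exits r t 0) 1 ∧ Serves κ (exits r t 1) 0 := by
  classical
  by_cases hz : ∃ z, ¬ PathAvoiding r {z} (s 0) (t 1) ∧ ¬ PathAvoiding r {z} (s 1) (t 0)
  · obtain ⟨z, hz1, hz2⟩ := hz
    obtain ⟨hp0, hp1⟩ := hcut z hz1 hz2
    -- Colour 2 stands for x₀+x₁; combined with the pure message at an exit it meets two colours.
    obtain ⟨κ, h1, h2, h3⟩ := N.exists_constant_coloring 2
    have hsc : ∀ v k, sourceColor r s t v = some k → κ v = some k := fun v k h => by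
      rw [h3 v fun hv => by simp [HasType.sourceColor_eq_none hv] at h, h]
    have key : ∀ i j : Fin 3, i ≠ j → i ≠ 2 → j ≠ 2 →
        (∃ g ∈ exits r t j, ∀ k, ReflTransGen r (s k) g ↔ k = j) →
        Serves κ (exits r t j) i := by
      rintro i j hij hi hj ⟨g', hg', hgs⟩
      obtain ⟨g, hg, -, h⟩ := N.exists_exit_of_path (fun _ _ h => h) hij hi hj (N.connected i j)
      rcases h with h | h
      · exact .inr ⟨g, hg, g', hg', 2, j, h2 g h,
          hsc g' j (sourceColor_eq_some.2 ⟨hj, hg'.1, hgs⟩), hj.symm⟩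
      · exact .inl ⟨g, hg, hsc g i h⟩
    refine ⟨κ, h1, fun v hv => by simp [h2 v hv], h3, key 1 0 (by decide) (by decide) (by decide)
      (N.exists_pure_exit hp0 ?_), key 0 1 (by decide) (by decide) (by decide)
      (N.exists_pure_exit hp1 ?_)⟩
    · intro k hk
      fin_cases k
      · exact absurd rfl hk
      · exact ⟨z, by simp, hz1, hz2⟩
      · exact ⟨e, by simp, N.cut_left⟩
    · intro k hk
      fin_cases k
      · exact ⟨z, by simp, hz2, hz1⟩
      · exact absurd rfl hk
      · exact ⟨f, by simp, N.cut_right⟩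
  have hz' : ∀ z, PathAvoiding r {z} (s 0) (t 1) ∨ PathAvoiding r {z} (s 1) (t 0) := by
    intro z
    by_contra! h
    exact hz ⟨z, h⟩
  by_cases hd0 : ∃ g ∈ exits r t 0, sourceColor r s t g = some 1
  · exact N.exists_coloring_of_direct (by decide) (by decide) (by decide) hd0
  by_cases hd1 : ∃ g ∈ exits r t 1, sourceColor r s t g = some 0
  · obtain ⟨κ, h1, h2, h3, h4, h5⟩ := N.exists_coloring_of_direct (by decide) (by decide) (by decide) hd1
    exact ⟨κ, h1, h2, h3, h5, h4⟩
  push Not at hd0 hd1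
  by_cases hu0 : Unseparated r {v | HasType r s t 2 v} (exits r t 0) (sourceColor r s t)
  · by_cases hu1 : Unseparated r {v | HasType r s t 2 v} (exits r t 1) (sourceColor r s t)
    · exact exists_coloring_of_unseparated N.acyclic (fun v hv => HasType.sourceColor_eq_none hv)
        (fun v hv => (N.exists_rel_hasType hv (i := 0) (by decide)).imp fun u hu =>
          ⟨hu.1, hu.2.imp id fun h => by simp [h]⟩) hu0 hu1 1 0
    · obtain ⟨κ, h1, h2, h3, h4, h5⟩ := N.exists_coloring_of_not_unseparated
        (by decide) (by decide) (by decide) hd1 hz' hu1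
      exact ⟨κ, h1, h2, h3, h5, h4⟩
  · exact N.exists_coloring_of_not_unseparated (by decide) (by decide) (by decide) hd0
      (fun z => (hz' z).symm) hu0

end IsCutNetwork

end Colors

/-! ### From colours to sums of messages -/

section Labels

variable {I : Type*} {r : I → I → Prop} {s t : Fin 3 → I} {e f : I} {F : Type*} [Field F]

/-- Adding and subtracting the sums of messages over the sets `L u`, for `u ∈ P`, one can get the
sum over the set `A`. -/
def IsXORCombination [Fintype I] (F : Type*) [Field F] (L : I → Finset (Fin 3)) (P : Set I)
    (A : Finset (Fin 3)) : Prop :=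
  ∃ c : I → F, (∀ u, c u ∈ ({0, 1, -1} : Set F)) ∧ (∀ u, c u ≠ 0 → u ∈ P) ∧
    ∀ x : Fin 3 → F, ∑ u, c u * ∑ i ∈ L u, x i = ∑ i ∈ A, x i

open Classical in
theorem IsXORCombination.of_finset [Fintype I] {L : I → Finset (Fin 3)} {P : Set I}
    {A : Finset (Fin 3)} (S : Finset I) (hS : ∀ u ∈ S, u ∈ P) (c : I → F)
    (hc : ∀ u, c u ∈ ({0, 1, -1} : Set F))
    (h : ∀ x : Fin 3 → F, ∑ u ∈ S, c u * ∑ i ∈ L u, x i = ∑ i ∈ A, x i) :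
    IsXORCombination F L P A := by
  refine ⟨fun u => if u ∈ S then c u else 0, fun u => ?_, fun u hu => ?_, fun x => ?_⟩
  · dsimp only
    split_ifs
    · exact hc u
    · simp
  · by_contra h
    exact hu (if_neg fun h' => h (hS u h'))
  · rw [← h x]
    simp [ite_mul, Finset.sum_ite_mem]

theorem IsXORCombination.of_eq [Fintype I] {L : I → Finset (Fin 3)} {P : Set I} {u : I}
    (hu : u ∈ P) : IsXORCombination F L P (L u) :=
  .of_finset {u} (by simpa using hu) (fun _ => 1) (by simp) (by simp)

open Classical in
theorem IsXORCombination.of_pair [Fintype I] {L : I → Finset (Fin 3)} {P : Set I}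
    {A : Finset (Fin 3)} {u v : I} (hu : u ∈ P) (hv : v ∈ P) (huv : u ≠ v) {a b : F}
    (ha : a ∈ ({0, 1, -1} : Set F)) (hb : b ∈ ({0, 1, -1} : Set F))
    (h : ∀ x : Fin 3 → F, a * ∑ i ∈ L u, x i + b * ∑ i ∈ L v, x i = ∑ i ∈ A, x i) :
    IsXORCombination F L P A :=
  .of_finset {u, v} (by simp [hu, hv]) (fun w => if w = u then a else b)
    (fun w => by split_ifs <;> assumption)
    (fun x => by rw [Finset.sum_pair huv, ← h x]; simp [huv.symm])

open Classical in
theorem IsXORCombination.of_triple [Fintype I] {L : I → Finset (Fin 3)} {P : Set I}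
    {A : Finset (Fin 3)} {u v w : I} (hu : u ∈ P) (hv : v ∈ P) (hw : w ∈ P)
    (huv : L u ≠ L v) (huw : L u ≠ L w) (hvw : L v ≠ L w)
    (h : ∀ x : Fin 3 → F, ∑ i ∈ L u, x i + ∑ i ∈ L v, x i - ∑ i ∈ L w, x i = ∑ i ∈ A, x i) :
    IsXORCombination F L P A := by
  replace huv : u ≠ v := fun h => huv (h ▸ rfl)
  replace huw : u ≠ w := fun h => huw (h ▸ rfl)
  replace hvw : v ≠ w := fun h => hvw (h ▸ rfl)
  refine .of_finset {u, v, w} (by simp [hu, hv, hw]) (fun z => if z = w then -1 else 1)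
    (fun z => by split_ifs <;> simp) (fun x => ?_)
  rw [Finset.sum_insert (by simp [huv, huw]), Finset.sum_pair hvw, ← h x]
  simp [huw, hvw]
  ring

/-- The messages of which a vertex with the given colour carries the sum. -/
def colorSet : Fin 3 → Finset (Fin 3) := ![{0}, {1}, {0, 1}]

theorem exists_xor_colorSet (d d' c : Fin 3) (hd : d ≠ d') :
    ∃ a ∈ ({0, 1, -1} : Set F), ∃ b ∈ ({0, 1, -1} : Set F), ∀ x : Fin 3 → F,
      a * ∑ i ∈ colorSet d, x i + b * ∑ i ∈ colorSet d', x i = ∑ i ∈ colorSet c, x i := by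
  by_cases h1 : c = d
  · exact ⟨1, by simp, 0, by simp, by simp [h1]⟩
  by_cases h2 : c = d'
  · exact ⟨0, by simp, 1, by simp, by simp [h2]⟩
  by_cases h3 : c = 2
  · refine ⟨1, by simp, 1, by simp, fun x => ?_⟩
    subst h3
    fin_cases d <;> fin_cases d' <;> (simp [colorSet] at *; try ring)
  by_cases h4 : d = 2
  · refine ⟨1, by simp, -1, by simp, fun x => ?_⟩
    subst h4
    fin_cases c <;> fin_cases d' <;> simp [colorSet] at *
  · refine ⟨-1, by simp, 1, by simp, fun x => ?_⟩
    fin_cases c <;> fin_cases d <;> fin_cases d' <;> simp [colorSet] at *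

open Classical in
/-- The set of messages of which a vertex carries the sum, given the colours of the vertices
that mix the first two messages. -/
noncomputable def labelOf (r : I → I → Prop) (s t : Fin 3 → I) (κ : I → Option (Fin 3)) (v : I) :
    Finset (Fin 3) :=
  if HasType r s t 2 v then (κ v).elim ∅ colorSet
  else Finset.univ.filter fun i => ReflTransGen r (s i) v

theorem labelOf_eq_colorSet {κ : I → Option (Fin 3)}
    (hκ : ∀ v, v ∉ {v | HasType r s t 2 v} → κ v = sourceColor r s t v) {v : I} {c : Fin 3}
    (h : κ v = some c) : labelOf r s t κ v = colorSet c := by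
  unfold labelOf
  split_ifs with hv
  · rw [h]; rfl
  · rw [hκ v hv] at h
    obtain ⟨hc, -, hs⟩ := sourceColor_eq_some.1 h
    ext i
    simp only [Finset.mem_filter, Finset.mem_univ, true_and, hs]
    fin_cases c <;> simp [colorSet] at hc ⊢

theorem labelOf_eq {κ : I → Option (Fin 3)} {v : I} (hv : ¬ HasType r s t 2 v)
    {A : Finset (Fin 3)} (h : ∀ i, ReflTransGen r (s i) v ↔ i ∈ A) :
    labelOf r s t κ v = A := by
  ext i
  simp [labelOf, hv, h]

theorem labelOf_of_hasType {κ : I → Option (Fin 3)} {v : I} {k : Fin 3} (hk : k ≠ 2)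
    (hv : HasType r s t k v) : labelOf r s t κ v = {k}ᶜ :=
  labelOf_eq (fun h => (h 2).1.1 ((hv 2).1.2 hk.symm) rfl) fun i => by simp [(hv i).1]

theorem labelOf_of_pure {κ : I → Option (Fin 3)} {v : I} {k : Fin 3}
    (hv : ∀ i, ReflTransGen r (s i) v ↔ i = k) : labelOf r s t κ v = {k} :=
  labelOf_eq (fun h => absurd (((hv 0).1 ((h 0).1.2 (by decide))).trans
    ((hv 1).1 ((h 1).1.2 (by decide))).symm) (by decide)) fun i => by simp [hv]

/-- Two different colours either include `c` or are exactly `o` and the mixed colour 2. -/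
theorem Serves.labels {κ : I → Option (Fin 3)}
    (hκ : ∀ v, v ∉ {v | HasType r s t 2 v} → κ v = sourceColor r s t v) {X : Set I}
    {c o : Fin 3} (hco : c ≠ o) (hc : c ≠ 2) (ho : o ≠ 2) (h : Serves κ X c) :
    (∃ g ∈ X, labelOf r s t κ g = {c}) ∨
      (∃ g ∈ X, labelOf r s t κ g = {o}) ∧ ∃ g ∈ X, labelOf r s t κ g = {0, 1} := by
  have hset : ∀ i : Fin 3, i ≠ 2 → colorSet i = {i} := by decide
  rcases h with ⟨g, hg, h⟩ | ⟨g, hg, g', hg', d, d', h, h', hne⟩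
  · exact .inl ⟨g, hg, hset c hc ▸ labelOf_eq_colorSet hκ h⟩
  · have hl := labelOf_eq_colorSet hκ h
    have hl' := labelOf_eq_colorSet hκ h'
    by_cases hdc : d = c
    · exact .inl ⟨g, hg, by rw [hl, hdc, hset c hc]⟩
    by_cases hdc' : d' = c
    · exact .inl ⟨g', hg', by rw [hl', hdc', hset c hc]⟩
    right
    by_cases hdo : d = o
    · have : d' = 2 := by omega
      exact ⟨⟨g, hg, by rw [hl, hdo, hset o ho]⟩, g', hg', by rw [hl', this]; rfl⟩
    · have h1 : d = 2 := by omega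
      have h2 : d' = o := by omega
      exact ⟨⟨g', hg', by rw [hl', h2, hset o ho]⟩, g, hg, by rw [hl, h1]; rfl⟩

theorem exists_rel_of_reaches {i : Fin 3} {v : I} (h : ReflTransGen r (s i) v)
    (hv : ∀ i, v ≠ s i) : ∃ u, r u v ∧ ReflTransGen r (s i) u := by
  rcases ReflTransGen.cases_tail h with h | ⟨u, h, hu⟩
  · exact absurd h (hv i)
  · exact ⟨u, hu, h⟩

namespace IsCutNetwork

variable (N : IsCutNetwork r s t e f)
include N

/-- For type 2 this is properness of the colouring. For another type k, a predecessor below one of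
the two sources either has type k, hence the same label, or carries that message alone; two pure
predecessors add up to the label. -/
theorem isXORCombination_labelOf [Fintype I] {κ : I → Option (Fin 3)}
    (hκ : ∀ v, v ∉ {v | HasType r s t 2 v} → κ v = sourceColor r s t v)
    (hC : ∀ v, HasType r s t 2 v → κ v ≠ none) (hp : ProperOn r {v | HasType r s t 2 v} κ)
    {v : I} (hv : IsShared r t v) (hvs : ∀ i, v ≠ s i) :
    IsXORCombination F (labelOf r s t κ) {u | r u v} (labelOf r s t κ v) := by
  by_cases hv2 : HasType r s t 2 v
  · obtain ⟨c, hc⟩ := Option.ne_none_iff_exists'.mp (hC v hv2)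
    have hl := labelOf_eq_colorSet hκ hc
    rw [hl]
    rcases hp v hv2 c hc with ⟨u, hu, huc⟩ | ⟨u, u', d, d', hu, hu', hd, hd', hne⟩
    · rw [← labelOf_eq_colorSet hκ huc]
      exact .of_eq hu
    · obtain ⟨a, ha, b, hb, h⟩ := exists_xor_colorSet (F := F) d d' c hne
      refine .of_pair hu hu' (fun h => hne ?_) ha hb fun x => ?_
      · rw [h, hd'] at hd
        exact (Option.some.inj hd).symm
      · rw [labelOf_eq_colorSet hκ hd, labelOf_eq_colorSet hκ hd', h]
  by_cases hJ : ∃ i j, i ≠ j ∧ ReflTransGen r (s i) v ∧ ReflTransGen r (s j) v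
  · obtain ⟨k, hk⟩ := N.exists_hasType hJ hv
    have hk2 : k ≠ 2 := by rintro rfl; exact hv2 hk
    rw [labelOf_of_hasType hk2 hk]
    have key : ∀ i, i ≠ k → (∃ u, r u v ∧ labelOf r s t κ u = {k}ᶜ) ∨
        ∃ u, r u v ∧ labelOf r s t κ u = {i} := by
      intro i hi
      obtain ⟨u, hu, hsu⟩ := exists_rel_of_reaches ((hk i).1.2 hi) hvs
      by_cases hJu : ∃ j, i ≠ j ∧ ReflTransGen r (s j) u
      · obtain ⟨j, hij, hj⟩ := hJu
        obtain ⟨l, hl⟩ := N.exists_hasType ⟨i, j, hij, hsu, hj⟩ (hv.of_reaches (.single hu))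
        obtain rfl : l = k := eq_of_ne_of_ne hij hi ((hk j).1.1 (hj.tail hu)) ((hl i).1.1 hsu)
          ((hl j).1.1 hj)
        exact .inl ⟨u, hu, labelOf_of_hasType hk2 hl⟩
      · push Not at hJu
        refine .inr ⟨u, hu, labelOf_of_pure fun j => ⟨fun hj => ?_, by rintro rfl; exact hsu⟩⟩
        by_contra hji
        exact hJu j (Ne.symm hji) hj
    obtain ⟨i, j, hij, hi, hj⟩ := exists_two k
    rcases key i hi with ⟨u, hu, h⟩ | ⟨u, hu, h⟩
    · exact h ▸ .of_eq hu
    rcases key j hj with ⟨u', hu', h'⟩ | ⟨u', hu', h'⟩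
    · exact h' ▸ .of_eq hu'
    refine .of_pair (a := 1) (b := 1) hu hu' ?_ (by simp) (by simp) fun x => ?_
    · rintro rfl
      rw [h, Finset.singleton_inj] at h'
      exact hij h'
    · rw [h, h', one_mul, one_mul, Finset.sum_singleton, Finset.sum_singleton,
        ← Finset.sum_pair hij]
      congr 1
      ext l
      simp only [Finset.mem_insert, Finset.mem_singleton, Finset.mem_compl]
      omega
  by_cases h1 : ∃ i, ReflTransGen r (s i) v
  · obtain ⟨i, hi⟩ := h1
    have hpure : ∀ {u}, ReflTransGen r u v → ReflTransGen r (s i) u →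
        ∀ k, ReflTransGen r (s k) u ↔ k = i := fun huv hu k => by
      refine ⟨fun hk => ?_, by rintro rfl; exact hu⟩
      by_contra hki
      exact hJ ⟨k, i, hki, hk.trans huv, hi⟩
    obtain ⟨u, hu, hsu⟩ := exists_rel_of_reaches hi hvs
    rw [labelOf_of_pure (hpure .refl hi), ← labelOf_of_pure (κ := κ) (hpure (.single hu) hsu)]
    exact .of_eq hu
  · rw [labelOf_eq hv2 (A := ∅) fun i => by simpa using fun h => h1 ⟨i, h⟩]
    exact .of_finset ∅ (by simp) (fun _ => 0) (by simp) (by simp)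

theorem exists_labelling [Fintype I] (F : Type*) [Field F]
    (hcenter : PathAvoiding r {e, f} (s 2) (t 2))
    (hcut : ∀ z, ¬ PathAvoiding r {z} (s 0) (t 1) → ¬ PathAvoiding r {z} (s 1) (t 0) →
      PathAvoiding r {e, z} (s 0) (t 0) ∧ PathAvoiding r {f, z} (s 1) (t 1)) :
    ∃ L : I → Finset (Fin 3), (∀ i, L (s i) = {i}) ∧
      (∀ v, IsShared r t v → (∀ i, v ≠ s i) → IsXORCombination F L {u | r u v} (L v)) ∧
      ∀ j, IsXORCombination F L (exits r t j) Finset.univ := by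
  obtain ⟨κ, h1, h2, h3, h4, h5⟩ := N.exists_serving_coloring hcut
  refine ⟨labelOf r s t κ, fun i => labelOf_of_pure fun k => ?_,
    fun v hv hvs => N.isXORCombination_labelOf h3 h2 h1 hv hvs, fun j => ?_⟩
  · exact N.source_reaches_source
  have key : ∀ {u j k}, k ≠ 2 → j ≠ k → HasType r s t k u →
      ∃ g ∈ exits r t j, labelOf r s t κ g = {k}ᶜ := by
    intro u j k hk hj hu
    obtain ⟨g, hg, h, -⟩ := N.exists_exit_hasType hu hj
    exact ⟨g, hg, labelOf_of_hasType hk h⟩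
  have hc0 : ({0}ᶜ : Finset (Fin 3)) = {1, 2} := by decide
  have hc1 : ({1}ᶜ : Finset (Fin 3)) = {0, 2} := by decide
  -- The exit of type `k` carries everything except the message `c = k`. What is added to it is
  -- either that message or the difference of x₀+x₁ and the message `j`.
  have serve : ∀ {j c k : Fin 3}, k ≠ 2 → j ≠ k → c = k → c ≠ j → j ≠ 2 →
      (∃ u, HasType r s t k u) → Serves κ (exits r t j) c →
      IsXORCombination F (labelOf r s t κ) (exits r t j) Finset.univ := by
    rintro j c k hk hjk rfl hcj hj ⟨u, hu⟩ hS
    obtain ⟨g, hg, hgl⟩ := key hk hjk hu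
    rcases hS.labels h3 hcj hk hj with ⟨g', hg', hgl'⟩ | ⟨⟨g', hg', hgl'⟩, g'', hg'', hgl''⟩
    · refine .of_pair (a := 1) (b := 1) hg hg' ?_ (by simp) (by simp) fun x => ?_
      · rintro rfl
        rw [hgl] at hgl'
        have := Finset.ext_iff.1 hgl' c
        simp at this
      · rw [hgl, hgl', one_mul, one_mul, Finset.sum_compl_add_sum]
    · have hcj' : c = 1 ∧ j = 0 ∨ c = 0 ∧ j = 1 := by omega
      refine .of_triple hg hg'' hg' ?_ ?_ ?_ fun x => ?_ <;>
        obtain ⟨rfl, rfl⟩ | ⟨rfl, rfl⟩ := hcj'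
      · rw [hgl, hgl'']; decide
      · rw [hgl, hgl'']; decide
      · rw [hgl, hgl']; decide
      · rw [hgl, hgl']; decide
      · rw [hgl'', hgl']; decide
      · rw [hgl'', hgl']; decide
      · rw [hgl, hgl', hgl'', hc1, Fin.sum_univ_three]
        simp
        ring
      · rw [hgl, hgl', hgl'', hc0, Fin.sum_univ_three]
        simp
        ring
  fin_cases j
  · exact serve (k := 1) (by decide) (by decide) rfl (by decide) (by decide)
      ⟨e, N.hasType_left⟩ h4
  · exact serve (k := 0) (by decide) (by decide) rfl (by decide) (by decide)
      ⟨f, N.hasType_right⟩ h5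
  · obtain ⟨g, hg, hgl⟩ := key (j := 2) (by decide) (by decide) N.hasType_left
    obtain ⟨g', hg', hgl'⟩ := key (j := 2) (by decide) (by decide) N.hasType_right
    obtain ⟨g'', hg'', h⟩ := N.exists_pure_exit hcenter fun k hk => by
      fin_cases k
      · exact ⟨e, by simp, N.cut_left.2, N.cut_left.1⟩
      · exact ⟨f, by simp, N.cut_right.2, N.cut_right.1⟩
      · exact absurd rfl hk
    have hgl'' := labelOf_of_pure (t := t) (κ := κ) h
    refine .of_triple hg hg' hg'' ?_ ?_ ?_ fun x => ?_
    · rw [hgl, hgl']; decide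
    · rw [hgl, hgl'']; decide
    · rw [hgl', hgl'']; decide
    · rw [hgl, hgl', hgl'', hc0, hc1, Fin.sum_univ_three]
      simp
      ring

end IsCutNetwork

end Labels

/-! ### Local coefficients and the funnels into single terminals -/

section Coefficients

variable {I : Type*} {r : I → I → Prop} {s t : Fin 3 → I} {e f : I}

theorem sum_chosen_successor {F : Type*} [Field F] [DecidableEq I] (D : Finset I) (n : I)
    (p : Prop) [Decidable p] (a : F) (hn : p → n ∈ D) :
    ∑ v ∈ D, (if p ∧ n = v then a else 0) = if p then a else 0 := by
  by_cases hp : p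
  · simp [hp, hn hp]
  · simp [hp]

open Classical in
/-- Local coefficients for a labelling of the vertices that reach several terminals. The vertices
that only reach `t j` pass on sums along chosen arcs towards `t j`. -/
theorem IsCutNetwork.exists_coefficients [Fintype I] (N : IsCutNetwork r s t e f)
    {F : Type*} [Field F] {L : I → Finset (Fin 3)} (hs : ∀ i, L (s i) = {i})
    (hL : ∀ v, IsShared r t v → (∀ i, v ≠ s i) → IsXORCombination F L {u | r u v} (L v))
    (ht : ∀ j, IsXORCombination F L (exits r t j) Finset.univ) :
    ∃ c : I → I → F, (∀ u v, c u v ∈ ({0, 1, -1} : Set F)) ∧ (∀ u v, ¬ r u v → c u v = 0) ∧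
      ∀ (x : Fin 3 → F) (y : I → F), (∀ i, y (s i) = x i) →
        (∀ v, (∀ i, v ≠ s i) → y v = ∑ u, c u v * y u) → ∀ j, y (t j) = ∑ i, x i := by
  have hL' : ∀ v, ∃ c : I → F, (∀ u, c u ∈ ({0, 1, -1} : Set F)) ∧ (∀ u, ¬ r u v → c u = 0) ∧
      (IsShared r t v → (∀ i, v ≠ s i) →
        ∀ x : Fin 3 → F, ∑ u, c u * ∑ i ∈ L u, x i = ∑ i ∈ L v, x i) := by
    intro v
    by_cases h : IsShared r t v ∧ ∀ i, v ≠ s i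
    · obtain ⟨c, h1, h2, h3⟩ := hL v h.1 h.2
      exact ⟨c, h1, fun u hu => by_contra fun hc => hu (h2 u hc), fun _ _ => h3⟩
    · exact ⟨fun _ => 0, by simp, by simp, fun h1 h2 => absurd ⟨h1, h2⟩ h⟩
  choose a ha1 ha2 ha3 using hL'
  choose b hb1 hb2 hb3 using ht
  set O : Fin 3 → I → Prop := fun j v => ∀ k, ReflTransGen r v (t k) ↔ k = j with hO
  -- Each exit towards `t j`, and each vertex other than `t j` that only reaches `t j`, selects a
  -- single successor that only reaches `t j`; no symbol is then duplicated on its way.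
  have hn : ∀ j u, ∃ x, u ∈ exits r t j ∨ O j u ∧ u ≠ t j → r u x ∧ O j x := by
    intro j u
    by_cases h : u ∈ exits r t j
    · obtain ⟨-, x, hx, hxj⟩ := h
      exact ⟨x, fun _ => ⟨hx, hxj⟩⟩
    by_cases h' : O j u ∧ u ≠ t j
    · rcases ReflTransGen.cases_head ((h'.1 j).2 rfl) with h1 | ⟨x, hx, hxj⟩
      · exact absurd h1 h'.2
      · refine ⟨x, fun _ => ⟨hx, fun k => ⟨fun hk => (h'.1 k).1 (.head hx hk), ?_⟩⟩⟩
        rintro rfl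
        exact hxj
    · exact ⟨u, fun h'' => (h''.elim h h').elim⟩
  choose n hn using hn
  have hOinj : ∀ {j k v}, O j v → O k v → j = k := fun hj hk => (hk _).1 ((hj _).2 rfl)
  have hOsh : ∀ {j v}, O j v → ¬ IsShared r t v := by
    rintro j v h ⟨k, l, hkl, hk, hl⟩
    exact hkl (((h k).1 hk).trans ((h l).1 hl).symm)
  have hOs : ∀ {j v}, O j v → ∀ i, v ≠ s i := by
    rintro j v h i rfl
    exact hOsh h (N.isShared_source i)
  -- Symbols inside the funnel are forwarded unchanged; exits enter it with the decoding weight `b`.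
  let w : Fin 3 → I → F := fun j u => if O j u then 1 else b j u
  refine ⟨fun u v => if IsShared r t v then a v u else if h : ∃ j, O j v then
    (if (r u v ∧ u ≠ t h.choose ∧ (u ∈ exits r t h.choose ∨ O h.choose u)) ∧
      n h.choose u = v then w h.choose u else 0) else 0, ?_, ?_, ?_⟩
  · intro u v
    dsimp only
    split_ifs
    · exact ha1 v u
    · simp only [w]
      split_ifs
      · simp
      · exact hb1 _ u
    all_goals simp
  · intro u v huv
    dsimp only
    split_ifs with h1 h2 h3
    · exact ha2 v u huv
    · exact absurd h3.1.1 huv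
    · rfl
    · rfl
  intro x y hxs hy j
  beta_reduce at hy
  have hshared : ∀ v, IsShared r t v → y v = ∑ i ∈ L v, x i := by
    intro v
    induction v using (wellFounded_of_acyclic N.acyclic).induction with
    | _ v ih =>
    intro hv
    by_cases hvs : ∀ i, v ≠ s i
    · rw [hy v hvs, ← ha3 v hv hvs x]
      refine Finset.sum_congr rfl fun u _ => ?_
      rw [if_pos hv]
      by_cases hu : r u v
      · rw [ih u (.single hu) (hv.of_reaches (.single hu))]
      · rw [ha2 v u hu, zero_mul, zero_mul]
    · push Not at hvs
      obtain ⟨i, rfl⟩ := hvs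
      rw [hxs, hs, Finset.sum_singleton]
  set D : Finset I := Finset.univ.filter (O j) with hD
  have hmemD : ∀ {v}, v ∈ D ↔ O j v := by simp [hD]
  have htj : O j (t j) := by
    intro k
    constructor
    · intro h
      rcases ReflTransGen.cases_head h with h | ⟨x, h, -⟩
      · exact N.terminal_injective h.symm
      · exact absurd h (N.not_terminal_rel _ _)
    · rintro rfl
      exact .refl
  have hstep : ∀ v ∈ D, y v = ∑ u, (if (u ≠ t j ∧ (u ∈ exits r t j ∨ O j u)) ∧
      n j u = v then w j u else 0) * y u := by
    intro v hv
    rw [hmemD] at hv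
    rw [hy v (hOs hv)]
    refine Finset.sum_congr rfl fun u _ => ?_
    have hex : ∃ j, O j v := ⟨j, hv⟩
    have hch : hex.choose = j := hOinj hex.choose_spec hv
    rw [if_neg (hOsh hv), dif_pos hex, hch]
    congr 1
    refine if_congr ?_ rfl rfl
    constructor
    · rintro ⟨⟨-, h⟩, h'⟩
      exact ⟨h, h'⟩
    · rintro ⟨⟨h, h'⟩, rfl⟩
      exact ⟨⟨(hn j u (h'.imp id fun h' => ⟨h', h⟩)).1, h, h'⟩, rfl⟩
  have hexit : ∀ u, b j u ≠ 0 → u ∈ exits r t j ∧ ¬ O j u ∧ u ≠ t j := fun u hu => by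
    have := hb2 j u hu
    exact ⟨this, fun h => hOsh h this.1, by rintro rfl; exact hOsh htj this.1⟩
  have hcoef : ∀ u, ∑ v ∈ D, (if (u ≠ t j ∧ (u ∈ exits r t j ∨ O j u)) ∧
      n j u = v then w j u else 0) =
      (if O j u then 1 else 0) - (if u = t j then 1 else 0) + b j u := by
    intro u
    rw [sum_chosen_successor D (n j u) _ (w j u) fun h =>
      hmemD.2 (hn j u (h.2.imp id fun h' => ⟨h', h.1⟩)).2]
    by_cases hbu : b j u = 0
    · by_cases hOu : O j u
      · by_cases hut : u = t j
        · simp [hut, htj, hut ▸ hbu]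
        · simp [hOu, hut, hbu, w]
      · have hut : u ≠ t j := by rintro rfl; exact hOu htj
        simp [hOu, hut, hbu, w]
    · obtain ⟨h1, h2, h3⟩ := hexit u hbu
      simp [h1, h2, h3, w]
  -- Double counting over the funnel: each of its symbols except that of `t j` is used once, along
  -- its chosen arc. Cancelling leaves `y (t j)` equal to the weighted sum over the exits.
  have hsum : ∑ v ∈ D, y v = ∑ v ∈ D, y v - y (t j) + ∑ u, b j u * y u := by
    conv_lhs => rw [Finset.sum_congr rfl hstep, Finset.sum_comm]
    simp_rw [← Finset.sum_mul, hcoef, add_mul, sub_mul, Finset.sum_add_distrib,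
      Finset.sum_sub_distrib, ite_mul, one_mul, zero_mul]
    rw [← Finset.sum_filter]
    simp [hD]
  have : y (t j) = ∑ u, b j u * y u := by linear_combination hsum
  rw [this, ← hb3 j x]
  refine Finset.sum_congr rfl fun u _ => ?_
  by_cases hbu : b j u = 0
  · simp [hbu]
  · rw [hshared u (hb2 j u hbu).1]

end Coefficients

/-! ### Paths in the network and paths of symbols -/

section LineGraph

variable {V E : Type*} {l m : ℕ}

/-- The relation "may use the symbol of" on the messages, the edges and the terminals. -/
def Feeds (N : SumNetwork V E l m) : Fin l ⊕ E ⊕ Fin m → Fin l ⊕ E ⊕ Fin m → Prop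
  | .inl i, .inr (.inl e) => N.source i = N.tail e
  | .inr (.inl e), .inr (.inl e') => N.head e = N.tail e'
  | .inr (.inl e), .inr (.inr j) => N.head e = N.terminal j
  | _, _ => False

variable (N : SumNetwork V E l m)

theorem not_feeds_inl (u : Fin l ⊕ E ⊕ Fin m) (i : Fin l) : ¬ N.Feeds u (.inl i) := by
  rcases u with _ | _ | _ <;> exact id

theorem not_terminal_feeds (j : Fin m) (v : Fin l ⊕ E ⊕ Fin m) :
    ¬ N.Feeds (.inr (.inr j)) v := by
  rcases v with _ | _ | _ <;> exact id

/-- The edges in `R`, as symbols. -/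
abbrev edgeSymbols (R : Set E) : Set (Fin l ⊕ E ⊕ Fin m) := {v | ∃ e ∈ R, v = .inr (.inl e)}

theorem edge_transGen {e : E} {v : Fin l ⊕ E ⊕ Fin m} (h : TransGen N.Feeds (.inr (.inl e)) v) :
    ∀ e', v = .inr (.inl e') → N.Reaches ∅ (N.tail e) (N.tail e') := by
  have hstep : ∀ e e' : E, N.head e = N.tail e' → N.Step ∅ (N.tail e) (N.tail e') :=
    fun e e' h => ⟨e, by simp, rfl, h⟩
  induction h with
  | single h =>
    rintro e' rfl
    exact .single (hstep _ _ h)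
  | @tail b c _ hbc ih =>
    rintro e' rfl
    rcases b with i | e'' | j
    · rename_i hb
      rcases TransGen.tail'_iff.1 hb with ⟨u, -, hu⟩
      exact absurd hu (N.not_feeds_inl _ _)
    · exact (ih e'' rfl).tail (hstep _ _ hbc)
    · exact absurd hbc (N.not_terminal_feeds _ _)

theorem feeds_acyclic (v : Fin l ⊕ E ⊕ Fin m) : ¬ TransGen N.Feeds v v := by
  intro h
  rcases v with i | e | j
  · obtain ⟨u, -, hu⟩ := TransGen.tail'_iff.1 h
    exact N.not_feeds_inl _ _ hu
  · refine N.acyclic (N.tail e) (TransGen.mono ?_ _ _ (N.edge_transGen h e rfl))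
    rintro u w ⟨e, -, h1, h2⟩
    exact ⟨e, h1, h2⟩
  · obtain ⟨u, hu, -⟩ := TransGen.head'_iff.1 h
    exact N.not_terminal_feeds _ _ hu

variable {N}

theorem pathAvoiding_of_reaches {R : Set E} {i : Fin l} {w : V}
    (h : N.Reaches R (N.source i) w) :
    ∃ e, N.head e = w ∧ PathAvoiding N.Feeds (edgeSymbols R) (.inl i) (.inr (.inl e)) := by
  induction h with
  | single h =>
    obtain ⟨e, he, h1, h2⟩ := h
    exact ⟨e, h2, .single ⟨h1.symm, by simpa using he⟩⟩
  | tail _ h ih =>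
    obtain ⟨e, he, h1, h2⟩ := h
    obtain ⟨e', he', hp⟩ := ih
    exact ⟨e, h2, hp.tail ⟨he'.trans h1.symm, by simpa using he⟩⟩

theorem reaches_of_pathAvoiding {R : Set E} {i : Fin l} {v : Fin l ⊕ E ⊕ Fin m}
    (h : PathAvoiding N.Feeds (edgeSymbols R) (.inl i) v) :
    (∀ e, v = .inr (.inl e) → N.Reaches R (N.source i) (N.head e)) ∧
      ∀ j, v = .inr (.inr j) → N.Reaches R (N.source i) (N.terminal j) := by
  induction h with
  | refl => simp
  | @tail a b ha hab ih =>
    obtain ⟨hab, hb⟩ := hab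
    constructor
    · rintro e rfl
      have he : e ∉ R := by simpa using hb
      rcases a with k | e' | j
      · obtain rfl : k = i := by
          rcases ReflTransGen.cases_tail ha with h | ⟨u, -, hu⟩
          · exact Sum.inl_injective h
          · exact absurd hu.1 (N.not_feeds_inl _ _)
        exact .single ⟨e, he, hab.symm, rfl⟩
      · exact (ih.1 e' rfl).tail ⟨e, he, hab.symm, rfl⟩
      · exact absurd hab (N.not_terminal_feeds _ _)
    · rintro j rfl
      rcases a with k | e' | j'
      · exact absurd hab id
      · have := ih.1 e' rfl
        rwa [show N.head e' = N.terminal j from hab] at this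
      · exact absurd hab (N.not_terminal_feeds _ _)

theorem pathAvoiding_iff_reaches {R : Set E} {i : Fin l} {j : Fin m} :
    PathAvoiding N.Feeds (edgeSymbols R) (.inl i) (.inr (.inr j)) ↔
      N.Reaches R (N.source i) (N.terminal j) := by
  refine ⟨fun h => (reaches_of_pathAvoiding h).2 j rfl, fun h => ?_⟩
  obtain ⟨e, he, hp⟩ := pathAvoiding_of_reaches h
  exact hp.tail ⟨he, by simp⟩

theorem edgeReaches_of_feeds {e : E} {v : Fin l ⊕ E ⊕ Fin m}
    (h : ReflTransGen N.Feeds (.inr (.inl e)) v) :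
    ∀ e', v = .inr (.inl e') → e = e' ∨ N.EdgeReaches e e' := by
  induction h with
  | refl =>
    intro e' h
    simp at h
    exact .inl h
  | @tail a b ha hab ih =>
    rintro e' rfl
    rcases a with i | e'' | j
    · rcases ReflTransGen.cases_tail ha with h | ⟨u, -, hu⟩
      · simp at h
      · exact absurd hu (N.not_feeds_inl _ _)
    · have hstep : N.Step ∅ (N.tail e'') (N.tail e') := ⟨e'', by simp, rfl, hab⟩
      rcases ih e'' rfl with rfl | h | h
      · exact .inr (.inl hab)
      · exact .inr (.inr (h ▸ .single hstep))
      · exact .inr (.inr (h.tail hstep))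
    · exact absurd hab (N.not_terminal_feeds _ _)

theorem feeds_of_edgeReaches {e e' : E} (h : N.EdgeReaches e e') :
    ReflTransGen N.Feeds (.inr (.inl e)) (.inr (.inl e')) := by
  have key : ∀ w, N.Reaches ∅ (N.head e) w →
      ∃ e'', N.head e'' = w ∧ ReflTransGen N.Feeds (.inr (.inl e)) (.inr (.inl e'')) := by
    intro w h
    induction h with
    | single h =>
      obtain ⟨e'', -, h1, h2⟩ := h
      exact ⟨e'', h2, .single h1.symm⟩
    | tail _ h ih =>
      obtain ⟨e'', -, h1, h2⟩ := h
      obtain ⟨e₁, h3, h4⟩ := ih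
      exact ⟨e'', h2, h4.tail (h3.trans h1.symm)⟩
  rcases h with h | h
  · exact .single h
  · obtain ⟨e'', h1, h2⟩ := key _ h
    exact h2.tail h1

end LineGraph

/-! ### Network codes from coefficients on symbols -/

section Codes

variable {V E : Type*} {l m : ℕ}

/-- In an acyclic network the local coefficients determine the symbols. -/
theorem exists_transmits [Fintype E] [DecidableEq V] {F : Type*} [Field F]
    {N : SumNetwork V E l m} (C : N.LinearCode F) (x : Fin l → F) : ∃ y, C.Transmits x y := by
  classical
  have hwf : WellFounded fun e' e : E => N.head e' = N.tail e := by
    refine Subrelation.wf (r := InvImage (TransGen N.Feeds) fun e => .inr (.inl e))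
      (fun {e' e} h => TransGen.single h) (InvImage.wf _ (wellFounded_of_acyclic N.feeds_acyclic))
  let G : (e : E) → ((e' : E) → N.head e' = N.tail e → F) → F := fun e y =>
    ∑ i with N.source i = N.tail e, C.messageCoeff i e * x i +
      ∑ e', if h : N.head e' = N.tail e then C.edgeCoeff e' e * y e' h else 0
  refine ⟨hwf.fix G, fun e => ?_⟩
  rw [hwf.fix_eq]
  simp only [G]
  congr 1
  rw [Finset.sum_filter]
  refine Finset.sum_congr rfl fun e' _ => ?_
  split_ifs <;> rfl

theorem xorSolvable_of_coefficients [Fintype E] [DecidableEq V] {F : Type*} [Field F]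
    {N : SumNetwork V E l m} (c : Fin l ⊕ E ⊕ Fin m → Fin l ⊕ E ⊕ Fin m → F)
    (hc : ∀ u v, c u v ∈ ({0, 1, -1} : Set F)) (hr : ∀ u v, ¬ N.Feeds u v → c u v = 0)
    (h : ∀ (x : Fin l → F) (y : Fin l ⊕ E ⊕ Fin m → F), (∀ i, y (.inl i) = x i) →
      (∀ v, (∀ i, v ≠ .inl i) → y v = ∑ u, c u v * y u) →
        ∀ j, y (.inr (.inr j)) = ∑ i, x i) : N.XORSolvable F := by
  let C : N.LinearCode F :=
    { messageCoeff := fun i e => c (.inl i) (.inr (.inl e))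
      edgeCoeff := fun e e' => c (.inr (.inl e)) (.inr (.inl e'))
      -- `Feeds` has no arc from a message to a terminal, so messages generated at a terminal itself
      -- are never used in decoding.
      decodeMessageCoeff := fun _ _ => 0
      decodeEdgeCoeff := fun e j => c (.inr (.inl e)) (.inr (.inr j)) }
  refine ⟨C, ⟨fun _ _ => hc _ _, fun _ _ => hc _ _, fun _ _ => by simp [C], fun _ _ => hc _ _⟩,
    fun x => ?_⟩
  obtain ⟨y, hy⟩ := exists_transmits C x
  refine ⟨y, hy, fun j => ?_⟩
  have hterm : ∀ (j : Fin m) v, c (.inr (.inr j)) v = 0 := fun j v =>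
    hr _ _ (N.not_terminal_feeds j v)
  rw [← h x (Sum.elim x (Sum.elim y (C.decode x y))) (fun _ => rfl) ?_ j]
  · rfl
  rintro (i | e | j) hv
  · exact absurd rfl (hv i)
  · simp only [Sum.elim_inr, Sum.elim_inl, Fintype.sum_sum_type, hterm, zero_mul,
      Finset.sum_const_zero, add_zero]
    rw [hy e, Finset.sum_filter, Finset.sum_filter]
    congr 1
    · refine Finset.sum_congr rfl fun i _ => ?_
      split_ifs with hi
      · rfl
      · rw [hr (.inl i) (.inr (.inl e)) hi, zero_mul]
    · refine Finset.sum_congr rfl fun e' _ => ?_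
      split_ifs with hi
      · rfl
      · rw [hr (.inr (.inl e')) (.inr (.inl e)) hi, zero_mul]
  · simp only [Sum.elim_inr, Sum.elim_inl, Fintype.sum_sum_type, hterm, zero_mul,
      Finset.sum_const_zero, add_zero]
    have h0 : ∀ i : Fin l, c (.inl i) (.inr (.inr j)) = 0 := fun i => hr _ _ id
    simp only [h0, zero_mul, Finset.sum_const_zero, zero_add, LinearCode.decode, C]
    rw [Finset.sum_filter]
    refine Finset.sum_congr rfl fun e' _ => ?_
    split_ifs with hi
    · rfl
    · rw [hr (.inr (.inl e')) (.inr (.inr j)) hi, zero_mul]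

theorem XORSolvable.of_relabel [Fintype E] [DecidableEq V] {F : Type*} [Field F]
    {N : SumNetwork V E l m} (σ : Equiv.Perm (Fin l)) (τ : Equiv.Perm (Fin m))
    (h : (N.relabel σ τ).XORSolvable F) : N.XORSolvable F := by
  obtain ⟨C, hC, hsum⟩ := h
  have key : ∀ (v : V) (g : Fin l → F), ∑ i with N.source i = v, g i =
      ∑ i with (N.relabel σ τ).source i = v, g (σ i) := by
    intro v g
    rw [Finset.sum_filter, Finset.sum_filter, ← Equiv.sum_comp σ]
    rfl
  refine ⟨⟨fun i e => C.messageCoeff (σ.symm i) e, C.edgeCoeff,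
    fun i j => C.decodeMessageCoeff (σ.symm i) (τ.symm j),
    fun e j => C.decodeEdgeCoeff e (τ.symm j)⟩,
    ⟨fun _ _ => hC.messageCoeff_mem _ _, hC.edgeCoeff_mem, fun _ _ => hC.decodeMessageCoeff_mem _ _,
      fun _ _ => hC.decodeEdgeCoeff_mem _ _⟩, fun x => ?_⟩
  obtain ⟨y, hy, hd⟩ := hsum (x ∘ σ)
  refine ⟨y, fun e => ?_, fun j => ?_⟩
  · rw [hy e, key]
    simp [relabel]
    rfl
  · have := hd (τ.symm j)
    rw [← Equiv.sum_comp σ]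
    refine Eq.trans ?_ this
    simp only [LinearCode.decode]
    rw [key]
    simp [relabel]
    rfl

end Codes

/-! ### A third cut, incomparable with the first two -/

section ThirdCut

variable {I : Type*} {r : I → I → Prop} {s t : Fin 3 → I} {e f z : I}

theorem IsCutNetwork.third_cut (N : IsCutNetwork r s t e f)
    (h₁ : ¬ PathAvoiding r {z} (s 0) (t 1)) (h₂ : ¬ PathAvoiding r {z} (s 1) (t 0)) :
    HasType r s t 2 z ∧ (¬ ReflTransGen r e z ∧ ¬ ReflTransGen r z e) ∧
      ¬ ReflTransGen r f z ∧ ¬ ReflTransGen r z f := by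
  obtain ⟨s0, t1⟩ := reaches_of_cut h₁ (N.connected 0 1)
  obtain ⟨s1, t0⟩ := reaches_of_cut h₂ (N.connected 1 0)
  have he : ¬ ReflTransGen r e z ∧ ¬ ReflTransGen r z e :=
    ⟨fun h => (N.hasType_left 1).2.1 (h.trans t1) rfl,
      fun h => (N.hasType_left 1).1.1 (s1.trans h) rfl⟩
  refine ⟨?_, he, fun h => (N.hasType_right 0).2.1 (h.trans t0) rfl,
    fun h => (N.hasType_right 0).1.1 (s0.trans h) rfl⟩
  have s2 : ¬ ReflTransGen r (s 2) z := fun h =>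
    (reaches_or_reached_of_cut N.cut_left.2 h t0).elim he.1 he.2
  have t2 : ¬ ReflTransGen r z (t 2) := fun h =>
    (reaches_or_reached_of_cut N.cut_left.1 s0 h).elim he.1 he.2
  intro i
  fin_cases i <;> simp [s0, s1, s2, t0, t1, t2]

/-- A vertex that separates `s i` from `t j` and `s j` from `t i` separates no other pair, if
suitable vertices are incomparable with it. -/
theorem cut_iff_of_incomparable (hconn : ∀ i j, ReflTransGen r (s i) (t j)) {a b c : I}
    {i j k : Fin 3} (hij : i ≠ j) (hik : i ≠ k) (hjk : j ≠ k) (ha : HasType r s t k a)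
    (h₁ : ¬ PathAvoiding r {a} (s i) (t j)) (h₂ : ¬ PathAvoiding r {a} (s j) (t i))
    {kb kc : Fin 3} (hb : HasType r s t kb b) (hc : HasType r s t kc c) (hib : i ≠ kb)
    (hjc : j ≠ kc) (hab : ¬ ReflTransGen r a b ∧ ¬ ReflTransGen r b a)
    (hac : ¬ ReflTransGen r a c ∧ ¬ ReflTransGen r c a) (p q : Fin 3) :
    ¬ PathAvoiding r {a} (s p) (t q) ↔ p = i ∧ q = j ∨ p = j ∧ q = i := by
  constructor
  · intro h
    by_contra hpq
    obtain ⟨hp, hq⟩ := reaches_of_cut h (hconn p q)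
    have hp := (ha p).1.1 hp
    have hq := (ha q).2.1 hq
    -- The type of `a` leaves only the two diagonal pairs. They are not cut, because `b` or `c` lies
    -- on a path of that pair and is incomparable with `a`.
    have : p = i ∧ q = i ∨ p = j ∧ q = j := by omega
    rcases this with ⟨rfl, rfl⟩ | ⟨rfl, rfl⟩
    · exact (reaches_or_reached_of_cut h ((hb _).1.2 hib) ((hb _).2.2 hib)).elim hab.1 hab.2
    · exact (reaches_or_reached_of_cut h ((hc _).1.2 hjc) ((hc _).2.2 hjc)).elim hac.1 hac.2
  · rintro (⟨rfl, rfl⟩ | ⟨rfl, rfl⟩)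
    · exact h₁
    · exact h₂

end ThirdCut

/-! ### Excluding bad pairs and assembling the code -/

section Main

variable {V E : Type*} {N : SumNetwork V E 3 3}

theorem isBadPair_relabel (hconn : N.Connected) (π : Equiv.Perm (Fin 3)) {a b : E}
    (ha : ∀ p q, ¬ N.Reaches {a} (N.source p) (N.terminal q) ↔
      p = π 0 ∧ q = π 2 ∨ p = π 2 ∧ q = π 0)
    (hb : ∀ p q, ¬ N.Reaches {b} (N.source p) (N.terminal q) ↔
      p = π 1 ∧ q = π 2 ∨ p = π 2 ∧ q = π 1)
    (hab : ¬ N.EdgeReaches a b ∧ ¬ N.EdgeReaches b a)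
    (hcut : ¬ N.Reaches {a, b} (N.source (π 2)) (N.terminal (π 2))) :
    (N.relabel π π).IsBadPair a b where
  exact_left := by
    ext ⟨p, q⟩
    have := ha (π p) (π q)
    simp only [EmbeddingLike.apply_eq_iff_eq] at this
    simp only [Set.mem_insert_iff, Set.mem_singleton_iff, Prod.mk.injEq, ← this]
    exact ⟨fun h => h.2, fun h => ⟨hconn _ _, h⟩⟩
  exact_right := by
    ext ⟨p, q⟩
    have := hb (π p) (π q)
    simp only [EmbeddingLike.apply_eq_iff_eq] at this
    simp only [Set.mem_insert_iff, Set.mem_singleton_iff, Prod.mk.injEq, ← this]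
    exact ⟨fun h => h.2, fun h => ⟨hconn _ _, h⟩⟩
  minCut_eq_zero := by
    refine Nat.sInf_eq_zero.2 (.inl ⟨∅, rfl, ?_⟩)
    rintro _ rfl _ rfl
    rw [Finset.coe_empty, Set.union_empty]
    exact hcut
  unreachable := hab

theorem pathAvoiding_singleton_iff {e : E} {i j : Fin 3} :
    PathAvoiding N.Feeds {.inr (.inl e)} (.inl i) (.inr (.inr j)) ↔
      N.Reaches {e} (N.source i) (N.terminal j) := by
  rw [← pathAvoiding_iff_reaches]
  simp [edgeSymbols]

theorem pathAvoiding_pair_iff {e e' : E} {i j : Fin 3} :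
    PathAvoiding N.Feeds {.inr (.inl e), .inr (.inl e')} (.inl i) (.inr (.inr j)) ↔
      N.Reaches {e, e'} (N.source i) (N.terminal j) := by
  rw [← pathAvoiding_iff_reaches]
  have : edgeSymbols (l := 3) (m := 3) {e, e'} = {.inr (.inl e), .inr (.inl e')} := by
    ext; simp [edgeSymbols]
  rw [this]

theorem isCutNetwork_feeds (hconn : N.Connected) {e₁ e₂ : E} (hne : e₁ ≠ e₂)
    (h₁ : ¬ N.Reaches {e₁} (N.source 0) (N.terminal 2) ∧
      ¬ N.Reaches {e₁} (N.source 2) (N.terminal 0))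
    (h₂ : ¬ N.Reaches {e₂} (N.source 1) (N.terminal 2) ∧
      ¬ N.Reaches {e₂} (N.source 2) (N.terminal 1))
    (h : ¬ N.EdgeReaches e₁ e₂ ∧ ¬ N.EdgeReaches e₂ e₁) :
    IsCutNetwork N.Feeds .inl (fun j => .inr (.inr j)) (.inr (.inl e₁)) (.inr (.inl e₂)) where
  acyclic := N.feeds_acyclic
  source_injective := Sum.inl_injective
  terminal_injective := Sum.inr_injective.comp Sum.inr_injective
  not_rel_source := N.not_feeds_inl
  not_terminal_rel := N.not_terminal_feeds
  connected i j := (pathAvoiding_iff_reaches.2 (hconn i j)).reaches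
  cut_left := ⟨mt pathAvoiding_singleton_iff.1 h₁.1, mt pathAvoiding_singleton_iff.1 h₁.2⟩
  cut_right := ⟨mt pathAvoiding_singleton_iff.1 h₂.1, mt pathAvoiding_singleton_iff.1 h₂.2⟩
  not_reaches := ⟨fun h' => (edgeReaches_of_feeds h' _ rfl).elim hne h.1,
    fun h' => (edgeReaches_of_feeds h' _ rfl).elim hne.symm h.2⟩

theorem xorSolvable_of_cutEdges [Fintype E] [DecidableEq V] (hconn : N.Connected)
    (hpair : ∀ (σ τ : Equiv.Perm (Fin 3)) (a b : E), ¬ (N.relabel σ τ).IsBadPair a b)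
    {e₁ e₂ : E} (hne : e₁ ≠ e₂)
    (h₁ : ¬ N.Reaches {e₁} (N.source 0) (N.terminal 2) ∧
      ¬ N.Reaches {e₁} (N.source 2) (N.terminal 0))
    (h₂ : ¬ N.Reaches {e₂} (N.source 1) (N.terminal 2) ∧
      ¬ N.Reaches {e₂} (N.source 2) (N.terminal 1))
    (h : ¬ N.EdgeReaches e₁ e₂ ∧ ¬ N.EdgeReaches e₂ e₁)
    (hcenter : N.Reaches {e₁, e₂} (N.source 2) (N.terminal 2)) (F : Type*) [Field F] :
    N.XORSolvable F := by
  have H := isCutNetwork_feeds hconn hne h₁ h₂ h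
  obtain ⟨L, hs, hL, ht⟩ := H.exists_labelling F (pathAvoiding_pair_iff.2 hcenter) (by
    intro z hz1 hz2
    obtain ⟨hz, hez, hfz⟩ := H.third_cut hz1 hz2
    -- A message is below one source only and a terminal reaches only itself, so a vertex of type 2
    -- is an edge.
    obtain ⟨e₃, rfl⟩ : ∃ e₃, z = .inr (.inl e₃) := by
      rcases z with k | e₃ | k
      · have a := H.source_reaches_source.1 ((hz 0).1.2 (by decide))
        have b := H.source_reaches_source.1 ((hz 1).1.2 (by decide))
        exact absurd (a.trans b.symm) (by decide)
      · exact ⟨e₃, rfl⟩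
      · have key : ∀ i, ReflTransGen N.Feeds (.inr (.inr k)) (.inr (.inr i)) → i = k := by
          intro i hi
          rcases ReflTransGen.cases_head hi with h | ⟨u, hu, -⟩
          · simpa using h.symm
          · exact absurd hu (N.not_terminal_feeds _ _)
        have a := key 0 ((hz 0).2.2 (by decide))
        have b := key 1 ((hz 1).2.2 (by decide))
        exact absurd (a.trans b.symm) (by decide)
    have he := fun p q => pathAvoiding_singleton_iff.not.symm.trans
      (cut_iff_of_incomparable H.connected (i := 0) (j := 2) (k := 1) (by decide) (by decide)
        (by decide) H.hasType_left H.cut_left.1 H.cut_left.2 hz H.hasType_right (by decide)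
        (by decide) hez H.not_reaches p q)
    have hf := fun p q => pathAvoiding_singleton_iff.not.symm.trans
      (cut_iff_of_incomparable H.connected (i := 1) (j := 2) (k := 0) (by decide) (by decide)
        (by decide) H.hasType_right H.cut_right.1 H.cut_right.2 hz H.hasType_left (by decide)
        (by decide) hfz H.not_reaches.symm p q)
    have hz := fun p q => pathAvoiding_singleton_iff.not.symm.trans
      (cut_iff_of_incomparable H.connected (i := 0) (j := 1) (k := 2) (by decide) (by decide)
        (by decide) hz hz1 hz2 H.hasType_left H.hasType_right (by decide)
        (by decide) hez.symm hfz.symm p q)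
    constructor
    · rw [pathAvoiding_pair_iff]
      by_contra hcut
      -- The cuts `e₁` and `e₃` share the index 0, which the swap moves to the central position 2;
      -- for `e₃` and `e₂` below, the shared index is 1.
      refine hpair _ _ e₁ e₃ (isBadPair_relabel hconn (Equiv.swap 0 2) (fun p q => ?_)
        (fun p q => ?_) ⟨mt feeds_of_edgeReaches hez.1, mt feeds_of_edgeReaches hez.2⟩ ?_)
      · rw [he, or_comm]; rfl
      · rw [hz, or_comm]; rfl
      · exact hcut
    · rw [pathAvoiding_pair_iff, Set.pair_comm]
      by_contra hcut
      refine hpair _ _ e₃ e₂ (isBadPair_relabel hconn (Equiv.swap 1 2) (fun p q => ?_)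
        (fun p q => ?_) ⟨mt feeds_of_edgeReaches hfz.2, mt feeds_of_edgeReaches hfz.1⟩ ?_)
      · exact hz p q
      · rw [hf, or_comm]; rfl
      · exact hcut)
  obtain ⟨c, hc, hr, hsum⟩ := H.exists_coefficients hs hL ht
  exact xorSolvable_of_coefficients c hc hr hsum

end Main
end SumNetwork

theorem mainTheorem6 {V E : Type*} [Fintype E] [DecidableEq V]
    (N : SumNetwork V E 3 3) (hconn : N.Connected)
    (hpair : ∀ (σ τ : Equiv.Perm (Fin 3)) (e₁ e₂ : E), ¬ (N.relabel σ τ).IsBadPair e₁ e₂)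
    (hedges : ∃ (σ τ : Equiv.Perm (Fin 3)) (e₁ e₂ : E),
      e₁ ≠ e₂ ∧
      N.Disconnects {e₁} (N.source (σ 0)) (N.terminal (τ 2)) ∧
      N.Disconnects {e₁} (N.source (σ 2)) (N.terminal (τ 0)) ∧
      N.Disconnects {e₂} (N.source (σ 1)) (N.terminal (τ 2)) ∧
      N.Disconnects {e₂} (N.source (σ 2)) (N.terminal (τ 1)) ∧
      ¬ N.EdgeReaches e₁ e₂ ∧ ¬ N.EdgeReaches e₂ e₁ ∧
      ¬ N.Disconnects {e₁, e₂} (N.source (σ 2)) (N.terminal (τ 2)))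
    (F : Type*) [Field F] :
    N.XORSolvable F := by
  obtain ⟨σ, τ, e₁, e₂, hne, h1, h2, h3, h4, h5, h6, h7⟩ := hedges
  refine SumNetwork.XORSolvable.of_relabel σ τ ?_
  refine SumNetwork.xorSolvable_of_cutEdges (N := N.relabel σ τ) (fun i j => hconn _ _)
    (fun σ' τ' a b => hpair (σ * σ') (τ * τ') a b) hne ⟨h1.2, h2.2⟩ ⟨h3.2, h4.2⟩ ⟨h5, h6⟩ ?_ F
  by_contra hcon
  exact h7 ⟨hconn _ _, hcon⟩
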